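/- Conventions. The weight $|t|$ of a binary tree $t$ is its number of empty sub-trees (one more than its number of nodes), and the weight $|n|$ of a node is that of the sub-tree rooted at it; an empty tree (weight $1$) is regarded as having two empty children of weight $1/2$, themselves having two empty children of weight $1/4$, and so on. For a node $n$ of a binary tree let $n_1,n_2$ be its left and right children and $n_{ij}$ the left ($j=1$) and right ($j=2$) children of $n_i$, and put $\mathrm{bal}_C(n)=\max_i|n_i|/|n|$, $\mathrm{bal}_{GC}(n)=\max_{i,j}|n_{ij}|/|n|$. The node $n$ is $(\alpha,\beta)$-balanced if $\mathrm{bal}_C(n)\le\alpha$ and $\mathrm{bal}_{GC}(n)\le\beta$; it is robustly $(\alpha,\beta)$-balanced if $\max_i|n_i|+1\le\alpha(|n|+1)$, $\max_i|n_i|\le\alpha(|n|-1)$, $\max_{i,j}|n_{ij}|+1\le\beta(|n|+1)$ and $\max_{i,j}|n_{ij}|\le\beta(|n|-1)$. A $\mathrm{GCB}(\alpha,\beta)$-tree is a tree all of whose nodes are $(\alpha,\beta)$-balanced. Balancing algorithms. They act on a tree with root $n$. The simple rotation turns $n=(n_1=(n_{11},n_{12}),n_2)$ into $n_1=(n_{11},n=(n_{12},n_2))$;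 the double rotation makes $n_{12}$ the root, with children $n_1=(n_{11},n_{121})$ and $n=(n_{122},n_2)$. $\mathsf C(u,v,w,x)$: if $|n_1|>u|n|+w$, do the simple rotation when $|n_{11}|\ge(1-v)|n|-x$ and the double rotation otherwise; if $|n_2|>u|n|+w$, do the mirror images (with $n_{22}$ in place of $n_{11}$); if $\max_i|n_i|\le u|n|+w$, do nothing. $\mathsf{GC}(y,z)$: do the simple rotation if $|n_{11}|>y|n|+z$, its mirror image if $|n_{22}|>y|n|+z$, the double rotation if $|n_{12}|>y|n|+z$, its mirror image if $|n_{21}|>y|n|+z$, and nothing if $\max_{i,j}|n_{ij}|\le y|n|+z$. $\mathsf{CGC}(u,v,y,\hat y)$: apply $\mathsf C(u,v,0,0)$; if the tree changed, apply $\mathsf{GC}(\hat y,0)$ to its left and right sub-trees and then to the whole tree; otherwise apply $\mathsf{GC}(y,0)$. $\mathsf{RCGC}(u,v,y,\hat y)$, with $\mathsf R(t)=\min\{-t,t-1\}$: apply $\mathsf C(u,v,\mathsf R(u),\mathsf R(v))$; if the tree changed, apply $\mathsf{CGC}(v,v,\hat y,\hat y)$ to its left and right sub-trees, then $\mathsf{GC}(\hat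 y,\mathsf R(\hat y))$ to the whole tree, then $\mathsf{CGC}(v,v,\hat y,\hat y)$ to the left and right sub-trees; otherwise apply $\mathsf{GC}(y,\mathsf R(y))$ and, if this changed the tree, apply $\mathsf{CGC}(v,v,\hat y,\hat y)$ to the left and right sub-trees. Top-down update. Given $\alpha,\beta$, let $$\hat\alpha=\frac{1-2\alpha+6\alpha^2-\sqrt{(1-\alpha)(5-\alpha)}}{5(2\alpha-1)},\qquad \hat\beta=\frac{1+\alpha-\sqrt{(1-\alpha)^2+4\alpha(\alpha^2-\beta)}}{2(1-\alpha^2+\beta)}\,\alpha .$$ To insert or delete a key $x$ in a binary search tree $\mathcal T$: if $\mathcal T$ has at most $29$ nodes, insert or delete $x$ (if possible) and replace the result by any perfectly balanced search tree with the same keys, i.e. one in which the weights of two siblings differ by at most $1$. If $\mathcal T$ has at least $30$ nodes, apply $\mathsf{RCGC}(\alpha,\hat\alpha,\beta,\hat\beta)$ to $\mathcal T$, then recursively update the left or right sub-tree, according to the comparison of $x$ with the key of the new root. If $x$ is the key of that root, stop in case of an insertion; in case of a deletion, delete in the same top-down way the least key of the right sub-tree, and let it replace $x$ at the root. Theorem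 4. Let $\alpha,\beta$ be real numbers with $1/\sqrt2\le\alpha<3/4$ and $\mathscr B(\alpha)\le\beta\le\alpha^2$, where $\mathscr B(\alpha)=(\sqrt{1+4\alpha}-1)/2$. Let $\mathcal T$ be a binary search tree that is a $\mathrm{GCB}(\alpha,\beta)$-tree, and let $x$ be a key (present in $\mathcal T$ or not). Then the top-down update algorithm, used to insert $x$ in $\mathcal T$ or to delete $x$ from $\mathcal T$, can be carried out, and every tree that it may produce is again a $\mathrm{GCB}(\alpha,\beta)$-tree, and is a binary search tree whose set of keys is that of $\mathcal T$ with $x$ added, respectively removed. Moreover, if $\mathcal T$ has at least $30$ nodes, then any tree produced from it by the $\mathsf{RCGC}(\alpha,\hat\alpha,\beta,\hat\beta)$-balancing algorithm has a robustly $(\alpha,\beta)$-balanced root, and its other nodes are $(\alpha,\beta)$-balanced. -/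

import Mathlib

/-! Grandchildren-balanced binary search trees and their top-down update algorithm.
Binary trees are Mathlib's `BinaryTree K`, whose nodes carry keys in `K`; `BinaryTree.nil` is the
empty tree. Algorithms are given as relations "input tree, output tree": a step whose rotation
cannot be performed has no output, and a step that leaves a choice has several outputs. -/

namespace GCBTree

open BinaryTree

/-- The weight of a tree: its number of empty sub-trees (the number of its nodes plus one). -/
def weight {K : Type*} (t : BinaryTree K) : ℝ := (t.numLeaves : ℝ)

/-! Weights of the children and grandchildren of the root. An empty tree, of weight `1`, counts as
having two empty children of weight `1/2` each, four grandchildren of weight `1/4` each, etc. -/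

/-- Weight of the left child of the root. -/
noncomputable def w₁ {K : Type*} : BinaryTree K → ℝ
  | nil => 1 / 2
  | node _ l _ => weight l

/-- Weight of the right child of the root. -/
noncomputable def w₂ {K : Type*} : BinaryTree K → ℝ
  | nil => 1 / 2
  | node _ _ r => weight r

/-- Weight of the left child of the left child of the root. -/
noncomputable def w₁₁ {K : Type*} : BinaryTree K → ℝ
  | nil => 1 / 4
  | node _ l _ => w₁ l

/-- Weight of the right child of the left child of the root. -/
noncomputable def w₁₂ {K : Type*} : BinaryTree K → ℝ
  | nil => 1 / 4
  | node _ l _ => w₂ l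

/-- Weight of the left child of the right child of the root. -/
noncomputable def w₂₁ {K : Type*} : BinaryTree K → ℝ
  | nil => 1 / 4
  | node _ _ r => w₁ r

/-- Weight of the right child of the right child of the root. -/
noncomputable def w₂₂ {K : Type*} : BinaryTree K → ℝ
  | nil => 1 / 4
  | node _ _ r => w₂ r

/-- Largest weight of a child of the root. -/
noncomputable def maxChild {K : Type*} (t : BinaryTree K) : ℝ := max (w₁ t) (w₂ t)

/-- Largest weight of a grandchild of the root. -/
noncomputable def maxGrandchild {K : Type*} (t : BinaryTree K) : ℝ :=
  max (max (w₁₁ t) (w₁₂ t)) (max (w₂₁ t) (w₂₂ t))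

/-- Child-balance of the root. -/
noncomputable def balC {K : Type*} (t : BinaryTree K) : ℝ := maxChild t / weight t

/-- Grandchild-balance of the root. -/
noncomputable def balGC {K : Type*} (t : BinaryTree K) : ℝ := maxGrandchild t / weight t

/-- The root is `(α, β)`-balanced. -/
def IsBalanced {K : Type*} (α β : ℝ) (t : BinaryTree K) : Prop := balC t ≤ α ∧ balGC t ≤ β

/-- The root is robustly `(α, β)`-balanced. -/
def RobustlyBalanced {K : Type*} (α β : ℝ) (t : BinaryTree K) : Prop :=
  (maxChild t + 1 ≤ α * (weight t + 1) ∧ maxChild t ≤ α * (weight t - 1)) ∧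
  (maxGrandchild t + 1 ≤ β * (weight t + 1) ∧ maxGrandchild t ≤ β * (weight t - 1))

/-- `GCB(α, β)`-trees: every node is `(α, β)`-balanced. -/
def IsGCB {K : Type*} (α β : ℝ) : BinaryTree K → Prop
  | nil => True
  | node a l r => IsBalanced α β (node a l r) ∧ IsGCB α β l ∧ IsGCB α β r

/-- Robust `GCB(α, β)`-trees: the root is robustly `(α, β)`-balanced and the other nodes are
`(α, β)`-balanced. -/
def IsRGCB {K : Type*} (α β : ℝ) : BinaryTree K → Prop
  | nil => True
  | node a l r => RobustlyBalanced α β (node a l r) ∧ IsGCB α β l ∧ IsGCB α β r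

/-- The weights of any two siblings differ by at most `1`. -/
def PerfectlyBalanced {K : Type*} : BinaryTree K → Prop
  | nil => True
  | node _ l r => |weight l - weight r| ≤ 1 ∧ PerfectlyBalanced l ∧ PerfectlyBalanced r

/-- The set of keys of a tree. -/
def keys {K : Type*} : BinaryTree K → Set K
  | nil => ∅
  | node a l r => insert a (keys l ∪ keys r)

/-- Binary search trees (without repeated keys). -/
def IsBST {K : Type*} [LinearOrder K] : BinaryTree K → Prop
  | nil => True
  | node a l r => (∀ k ∈ keys l, k < a) ∧ (∀ k ∈ keys r, a < k) ∧ IsBST l ∧ IsBST r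

/-! Rotations. -/

/-- Simple rotation lifting the left child of the root. -/
inductive SimpleRot {K : Type*} : BinaryTree K → BinaryTree K → Prop
  | mk (n n₁ : K) (A B C : BinaryTree K) :
      SimpleRot (node n (node n₁ A B) C) (node n₁ A (node n B C))

/-- Mirror image of the simple rotation. -/
inductive SimpleRotMirror {K : Type*} : BinaryTree K → BinaryTree K → Prop
  | mk (n n₂ : K) (A B C : BinaryTree K) :
      SimpleRotMirror (node n A (node n₂ B C)) (node n₂ (node n A B) C)

/-- Double rotation lifting the right child of the left child of the root. -/
inductive DoubleRot {K : Type*} : BinaryTree K → BinaryTree K → Prop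
  | mk (n n₁ n₁₂ : K) (A B C D : BinaryTree K) :
      DoubleRot (node n (node n₁ A (node n₁₂ B C)) D) (node n₁₂ (node n₁ A B) (node n C D))

/-- Mirror image of the double rotation. -/
inductive DoubleRotMirror {K : Type*} : BinaryTree K → BinaryTree K → Prop
  | mk (n n₂ n₂₁ : K) (A B C D : BinaryTree K) :
      DoubleRotMirror (node n A (node n₂ (node n₂₁ B C) D)) (node n₂₁ (node n A B) (node n₂ C D))

/-! Local rebalancing algorithms. -/

/-- The `C(u, v, w, x)`-balancing algorithm transforms `T` into `T'`. -/
inductive CBalancing {K : Type*} (u v w x : ℝ) (T T' : BinaryTree K) : Prop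
  | case1 (h : w₁ T > u * weight T + w) (h' : w₁₁ T ≥ (1 - v) * weight T - x)
      (rot : SimpleRot T T')
  | case2 (h : w₂ T > u * weight T + w) (h' : w₂₂ T ≥ (1 - v) * weight T - x)
      (rot : SimpleRotMirror T T')
  | case3 (h : w₁ T > u * weight T + w) (h' : w₁₁ T < (1 - v) * weight T - x)
      (rot : DoubleRot T T')
  | case4 (h : w₂ T > u * weight T + w) (h' : w₂₂ T < (1 - v) * weight T - x)
      (rot : DoubleRotMirror T T')
  | case5 (h : maxChild T ≤ u * weight T + w) (same : T' = T)

/-- The `GC(y, z)`-balancing algorithm transforms `T` into `T'`. -/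
inductive GCBalancing {K : Type*} (y z : ℝ) (T T' : BinaryTree K) : Prop
  | case1 (h : w₁₁ T > y * weight T + z) (rot : SimpleRot T T')
  | case2 (h : w₂₂ T > y * weight T + z) (rot : SimpleRotMirror T T')
  | case3 (h : w₁₂ T > y * weight T + z) (rot : DoubleRot T T')
  | case4 (h : w₂₁ T > y * weight T + z) (rot : DoubleRotMirror T T')
  | case5 (h : maxGrandchild T ≤ y * weight T + z) (same : T' = T)

/-- Both the left and the right sub-tree are transformed according to `S`. -/
inductive OnSubtrees {K : Type*} (S : BinaryTree K → BinaryTree K → Prop) :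
    BinaryTree K → BinaryTree K → Prop
  | mk (a : K) (l r l' r' : BinaryTree K) (hl : S l l') (hr : S r r') :
      OnSubtrees S (node a l r) (node a l' r')

/-- The `CGC(u, v, y, yh)`-balancing algorithm transforms `T` into `T'`. -/
inductive CGCBalancing {K : Type*} (u v y yh : ℝ) (T T' : BinaryTree K) : Prop
  | changed (T₁ T₂ : BinaryTree K) (h₁ : CBalancing u v 0 0 T T₁) (ne : T ≠ T₁)
      (h₂ : OnSubtrees (GCBalancing yh 0) T₁ T₂) (h₃ : GCBalancing yh 0 T₂ T')
  | unchanged (h₁ : CBalancing u v 0 0 T T) (h₂ : GCBalancing y 0 T T')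

/-- `R(t) = min {-t, t - 1}`. -/
noncomputable def R (t : ℝ) : ℝ := min (-t) (t - 1)

/-- The `RCGC(u, v, y, yh)`-balancing algorithm transforms `T` into `T'`. -/
inductive RCGCBalancing {K : Type*} (u v y yh : ℝ) (T T' : BinaryTree K) : Prop
  | changedC (T₁ T₂ T₃ : BinaryTree K) (h₁ : CBalancing u v (R u) (R v) T T₁) (ne : T ≠ T₁)
      (h₂ : OnSubtrees (CGCBalancing v v yh yh) T₁ T₂) (h₃ : GCBalancing yh (R yh) T₂ T₃)
      (h₄ : OnSubtrees (CGCBalancing v v yh yh) T₃ T')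
  | changedGC (T₃ : BinaryTree K) (h₁ : CBalancing u v (R u) (R v) T T)
      (h₂ : GCBalancing y (R y) T T₃) (ne : T ≠ T₃)
      (h₃ : OnSubtrees (CGCBalancing v v yh yh) T₃ T')
  | unchanged (h₁ : CBalancing u v (R u) (R v) T T) (h₂ : GCBalancing y (R y) T T)
      (same : T' = T)

/-! Parameters. -/

/-- The lower bound `B(α) = (√(1 + 4 α) - 1) / 2` on `β`. -/
noncomputable def B (α : ℝ) : ℝ := (√(1 + 4 * α) - 1) / 2

/-- The parameter `α̂`. -/
noncomputable def alphaHat (α : ℝ) : ℝ :=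
  (1 - 2 * α + 6 * α ^ 2 - √((1 - α) * (5 - α))) / (5 * (2 * α - 1))

/-- The parameter `β̂`. -/
noncomputable def betaHat (α β : ℝ) : ℝ :=
  (1 + α - √((1 - α) ^ 2 + 4 * α * (α ^ 2 - β))) / (2 * (1 - α ^ 2 + β)) * α

/-- The rebalancing that the top-down algorithm applies to a tree with `30` nodes or more before
it descends. -/
def Rebalance {K : Type*} (α β : ℝ) (T T₁ : BinaryTree K) : Prop :=
  RCGCBalancing α (alphaHat α) β (betaHat α β) T T₁

/-! The top-down update algorithm. Weights are functions of the tree, so that updating the weight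
fields is implicit: the algorithm never reads the weight of a node once it has descended below it,
and each weight that it does read is that of a sub-tree not updated yet. -/

/-- The top-down algorithm, asked to insert the key `x`, transforms `T` into `T'`. -/
inductive TDInsert {K : Type*} [LinearOrder K] (α β : ℝ) (x : K) :
    BinaryTree K → BinaryTree K → Prop
  | small (T T' : BinaryTree K) (size : T.numNodes ≤ 29) (bst : IsBST T')
      (hkeys : keys T' = insert x (keys T)) (perfect : PerfectlyBalanced T') :
      TDInsert α β x T T'
  | found (T l r : BinaryTree K) (size : 30 ≤ T.numNodes)
      (reb : Rebalance α β T (node x l r)) :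
      TDInsert α β x T (node x l r)
  | left (T : BinaryTree K) (a : K) (l r l' : BinaryTree K) (size : 30 ≤ T.numNodes)
      (reb : Rebalance α β T (node a l r)) (lt : x < a) (rec : TDInsert α β x l l') :
      TDInsert α β x T (node a l' r)
  | right (T : BinaryTree K) (a : K) (l r r' : BinaryTree K) (size : 30 ≤ T.numNodes)
      (reb : Rebalance α β T (node a l r)) (lt : a < x) (rec : TDInsert α β x r r') :
      TDInsert α β x T (node a l r')

/-- The top-down algorithm, asked to delete the least key of `T`, transforms `T` into `T'`, and
that key is `m`. -/
inductive TDDeleteMin {K : Type*} [LinearOrder K] (α β : ℝ) (m : K) :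
    BinaryTree K → BinaryTree K → Prop
  | small (T T' : BinaryTree K) (size : T.numNodes ≤ 29) (least : IsLeast (keys T) m)
      (bst : IsBST T') (hkeys : keys T' = keys T \ {m}) (perfect : PerfectlyBalanced T') :
      TDDeleteMin α β m T T'
  | left (T : BinaryTree K) (a : K) (l r l' : BinaryTree K) (size : 30 ≤ T.numNodes)
      (reb : Rebalance α β T (node a l r)) (rec : TDDeleteMin α β m l l') :
      TDDeleteMin α β m T (node a l' r)

/-- The top-down algorithm, asked to delete the key `x`, transforms `T` into `T'`. If `x` is found
at the root of a large tree, then the successor `m` of `x`, the least key of the right sub-tree, is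
deleted from that sub-tree and finally replaces `x`. -/
inductive TDDelete {K : Type*} [LinearOrder K] (α β : ℝ) (x : K) :
    BinaryTree K → BinaryTree K → Prop
  | small (T T' : BinaryTree K) (size : T.numNodes ≤ 29) (bst : IsBST T')
      (hkeys : keys T' = keys T \ {x}) (perfect : PerfectlyBalanced T') :
      TDDelete α β x T T'
  | found (T l r r' : BinaryTree K) (m : K) (size : 30 ≤ T.numNodes)
      (reb : Rebalance α β T (node x l r)) (rec : TDDeleteMin α β m r r') :
      TDDelete α β x T (node m l r')
  | left (T : BinaryTree K) (a : K) (l r l' : BinaryTree K) (size : 30 ≤ T.numNodes)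
      (reb : Rebalance α β T (node a l r)) (lt : x < a) (rec : TDDelete α β x l l') :
      TDDelete α β x T (node a l' r)
  | right (T : BinaryTree K) (a : K) (l r r' : BinaryTree K) (size : 30 ≤ T.numNodes)
      (reb : Rebalance α β T (node a l r)) (lt : a < x) (rec : TDDelete α β x r r') :
      TDDelete α β x T (node a l r')

end GCBTree

namespace GCBTree

open BinaryTree

/-! The descent is safe because a robust root has slack for the update still to come. If `M` bounds
the children (or grandchildren) of a tree of weight `n`, the two robustness inequalities say that
the bound survives a change of weight by `+1` and by `-1`; intermediate changes follow by linearity.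
For grandchildren it is not enough that the updated sub-tree changes its weight by at most `1`: its
heaviest child must be controlled too. This is the second clause of `IsUpdate`, which is carried
through the induction together with the balance of the result (`IsRGCB.update_left`,
`TDInsert.outcome`, `TDDelete.outcome`). For it to pass through a rebalancing, that rebalancing must
preserve the weight of the tree and never increase the weight of its heaviest child.

What remains is that a large `GCB`-tree becomes robust (`RCGCBalancing.isRGCB`). A rotation at its
root makes the root robust, but leaves the children with child-balance up to `3/4` only (the two
lemmas `outcome_large`). This is repaired by `CGCBalancing.isGCB`, for which `3/4` is good enough:
inside it, a `C`-step brings all child-balances down to `α`, and `GC`-steps then handle the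
grandchildren. Since the heaviest child of each repaired sub-tree does not grow, the grandchildren
of the root do not grow either (`OnSubtrees.outcome`), so the robustness of the root is not lost.

Each rotation reduces to inequalities between the weights of the sub-trees that it moves. They are
governed by `b = B α`, the positive root of `b + b² = α`: in a tree of weight `n` with child-balance
at most `α` at the root and its children, a grandchild of weight at least `b * n` forces its parent
to weigh at least `n / (1 + b)`, and leaves at most `b² * n` to its sibling. The explicit parameters
`alphaHat` and `betaHat` enter only through the bounds collected in `Admissible`. Finally, the
algorithm never gets stuck, because its thresholds are high enough for the nodes to be lifted to be
non-empty. -/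

/-- Numerical conditions on the parameters under which the rebalancing is analysed; the real `b`
stands for `B α`. -/
structure Admissible (α β v y b : ℝ) : Prop where
  b_ge : 239 / 500 ≤ b
  b_le : b ≤ 1 / 2
  α_eq : α = b + b ^ 2
  α_sq : 1 / 2 ≤ α ^ 2
  v_le : v ≤ α
  v_ge : 1 + α ≤ v * (1 + 2 * α)
  v_ge' : 18 / 25 * α + 123 / 625 ≤ v
  b_le_y : b ≤ y
  y_le : y ≤ β
  β_le : β ≤ α ^ 2
  le_y : α ≤ (2 - β) * y

/-! ### Elementary consequences of the numerical conditions -/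

namespace Admissible

variable {α β v y b : ℝ}

/-- A rational stand-in, slightly below `1/√2`; the lower bound `239/500` on `b` is the matching one
below `B (1/√2)`. -/
theorem α_ge (h : Admissible α β v y b) : 707 / 1000 ≤ α := by
  have := h.α_sq; have := h.α_eq; have := h.b_ge
  by_contra! hc
  nlinarith

theorem α_le (h : Admissible α β v y b) : α ≤ 3 / 4 := by
  have := h.α_eq; have := h.b_ge; have := h.b_le
  nlinarith

theorem b_le_β (h : Admissible α β v y b) : b ≤ β := h.b_le_y.trans h.y_le

theorem v_ge_seven (h : Admissible α β v y b) : 7 / 10 ≤ v := by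
  have := h.v_ge'; have := h.α_ge
  linarith

theorem β_le' (h : Admissible α β v y b) : β ≤ 9 / 16 := by
  have := h.β_le; have := h.α_ge; have := h.α_le
  nlinarith

/-- `2 b² + b ≤ 1`. -/
theorem b_sq_le (h : Admissible α β v y b) : b ^ 2 ≤ 1 - α := by
  have := h.b_ge; have := h.b_le; have := h.α_eq
  nlinarith

theorem α_sub_β_le (h : Admissible α β v y b) : α - β ≤ b ^ 2 := by
  have := h.b_le_β; have := h.α_eq
  linarith

/-- Three descents, each of ratio at most `α`, lead to at most `27/64` of the weight, which is less
than the share `b`. -/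
theorem α_cube_le (h : Admissible α β v y b) : α ^ 3 ≤ 27 / 64 := by
  have := h.α_ge; have := h.α_le
  have : α ^ 2 ≤ 9 / 16 := by nlinarith
  nlinarith

end Admissible

/-! ### Inequalities for rotations in trees of any size -/

/-- Effect of a simple rotation triggered by a heavy grandchild. -/
theorem simpleRot_gc {α β v y b a e p d n : ℝ} (h : Admissible α β v y b)
    (hpe : p = a + e) (hn : n = p + d) (ha0 : 0 < a) (he0 : 0 < e) (hd0 : 0 < d)
    (ha : a ≤ α * p) (hp : p ≤ α * n) (hg : b * n ≤ a) :
    (e + d ≤ α * n ∧ α * a ≤ β * n ∧ e ≤ β * n ∧ d ≤ β * n) ∧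
    (α * e ≤ β * (e + d) ∧ α * d ≤ β * (e + d)) ∧ d ≤ a := by
  have hα := h.α_eq; have hb := h.b_ge; have hb' := h.b_le; have hα1 := h.α_ge
  have hα2 := h.α_le; have hbβ := h.b_le_β; have hsq := h.b_sq_le; have hc := h.α_cube_le
  have hab := h.α_sub_β_le; have hβ9 := h.β_le'
  have hn0 : 0 < n := by linarith
  have hp0 : 0 < p := by linarith
  have hb0 : 0 < b := by linarith
  have hα0 : 0 < α := by linarith
  have h1α : 0 ≤ 1 - α := by linarith
  have hbb : b ^ 2 ≤ b := by nlinarith only [hb, hb']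
  -- The factorisation `α = b * (1 + b)` lets `b` be cancelled from `b * n ≤ a ≤ α * p`. The later
  -- bound `e ≤ b ^ 2 * n` comes from `p - a ≤ (α - b) * n`.
  have hp1 : n ≤ (1 + b) * p := by
    have : b * n ≤ b * ((1 + b) * p) := by
      calc b * n ≤ a := hg
        _ ≤ α * p := ha
        _ = b * ((1 + b) * p) := by rw [hα]; ring
    exact le_of_mul_le_mul_left this hb0
  have hd1 : (1 + b) * d ≤ b * n := by
    rw [show d = n - p by linarith]
    linarith
  have hd2 : d ≤ b * n := by linarith [mul_pos hb0 hd0]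
  have he1 : e ≤ b ^ 2 * n := by rw [hα] at hp; linarith
  have hd3 : (1 - α) * n ≤ d := by linarith
  have he3 : (1 - α) * p ≤ e := by linarith
  have hbn : b * n ≤ β * n := by gcongr
  -- The goals `α * e ≤ β * (e + d)` and `α * d ≤ β * (e + d)` are used in the forms `(α - β) * e ≤
  -- β * d` and `(α - β) * d ≤ β * e`; both chains rest on `α - β ≤ b ^ 2 ≤ 1 - α`.
  have e1 : (α - β) * e ≤ b ^ 2 * (b ^ 2 * n) :=
    mul_le_mul hab he1 he0.le (by positivity)
  have e2 : b ^ 2 * (b ^ 2 * n) ≤ b * ((1 - α) * n) := by gcongr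
  have e3 : b * ((1 - α) * n) ≤ β * d := mul_le_mul hbβ hd3 (by positivity) (by linarith)
  have d1 : (α - β) * d ≤ b ^ 2 * d := by gcongr
  have d2 : (1 + b) * (b ^ 2 * d) ≤ (1 + b) * (b * e) := by
    have h1 : b ^ 2 * ((1 + b) * d) ≤ (1 - α) * (b * n) := by gcongr
    have h2 : b * ((1 - α) * n) ≤ b * ((1 - α) * ((1 + b) * p)) := by gcongr
    have h3 : b * (1 + b) * ((1 - α) * p) ≤ b * (1 + b) * e := by gcongr
    linarith
  have d3 : b ^ 2 * d ≤ b * e := le_of_mul_le_mul_left d2 (by linarith)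
  have d4 : b * e ≤ β * e := by gcongr
  refine ⟨⟨?_, ?_, ?_, ?_⟩, ⟨?_, ?_⟩, ?_⟩
  · have : (1 - b) * n ≤ α * n := by gcongr; linarith
    linarith
  · have h1 : α * a ≤ α * (α * (α * n)) := by
      gcongr
      exact ha.trans (by gcongr)
    have h2 : α ^ 3 * n ≤ b * n := by gcongr; linarith
    linarith
  · have : b ^ 2 * n ≤ b * n := by gcongr
    linarith
  · linarith
  · linarith
  · linarith
  · linarith

/-- Effect of a double rotation triggered by a heavy grandchild. -/
theorem doubleRot_gc {α β v y b a f g k p d n : ℝ} (h : Admissible α β v y b)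
    (hk : k = f + g) (hpe : p = a + k) (hn : n = p + d)
    (ha0 : 0 < a) (hf0 : 0 < f) (hg0 : 0 < g) (hd0 : 0 < d)
    (hkp : k ≤ α * p) (hf : f ≤ α * k) (hg : g ≤ α * k)
    (hf' : f ≤ β * p) (hg' : g ≤ β * p) (hp : p ≤ α * n) (hy : b * n ≤ k) :
    (a + f ≤ α * n ∧ g + d ≤ α * n) ∧
    (a ≤ β * n ∧ f ≤ β * n ∧ g ≤ β * n ∧ d ≤ β * n) ∧
    (α * a ≤ β * (a + f) ∧ α * f ≤ β * (a + f)) ∧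
    (α * g ≤ β * (g + d) ∧ α * d ≤ β * (g + d)) := by
  have hα := h.α_eq; have hb := h.b_ge; have hb' := h.b_le; have hα1 := h.α_ge
  have hα2 := h.α_le; have hbβ := h.b_le_β; have hsq := h.b_sq_le; have hc := h.α_cube_le
  have hab := h.α_sub_β_le; have hβ9 := h.β_le'
  have hn0 : 0 < n := by linarith
  have hp0 : 0 < p := by linarith
  have hk0 : 0 < k := by linarith
  have hb0 : 0 < b := by linarith
  have hβ0 : 0 < β := by linarith
  have hα0 : 0 < α := by linarith
  have h1α : 0 ≤ 1 - α := by linarith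
  have hbb : b ^ 2 ≤ b := by nlinarith only [hb, hb']
  have hb4 : b ^ 2 ≤ 1 / 4 := by nlinarith only [hb, hb']
  have hp1 : n ≤ (1 + b) * p := by
    have : b * n ≤ b * ((1 + b) * p) := by
      calc b * n ≤ k := hy
        _ ≤ α * p := hkp
        _ = b * ((1 + b) * p) := by rw [hα]; ring
    exact le_of_mul_le_mul_left this hb0
  have hd1 : (1 + b) * d ≤ b * n := by
    rw [show d = n - p by linarith]
    linarith
  have hd2 : d ≤ b * n := by linarith [mul_pos hb0 hd0]
  have ha1 : a ≤ b ^ 2 * n := by rw [hα] at hp; linarith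
  have hd3 : (1 - α) * n ≤ d := by linarith
  have ha3 : (1 - α) * p ≤ a := by linarith
  have hf3 : (1 - α) * k ≤ f := by linarith
  have hg3 : (1 - α) * k ≤ g := by linarith
  have hbn : b * n ≤ β * n := by gcongr
  have hαk : α * k ≤ α ^ 3 * n := by
    calc α * k ≤ α * (α * (α * n)) := by
          gcongr
          exact hkp.trans (by gcongr)
      _ = _ := by ring
  have hc3 : α ^ 3 * n ≤ 27 / 64 * n := by gcongr
  have hb3 : 27 / 64 * n ≤ b * n := by gcongr; linarith
  have haf : (1 - α) * n ≤ a + f := by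
    have h1 : (1 + b) * ((1 - α) * n) ≤ (1 + b) * ((1 - α) * p + (1 - α) * k) := by
      have : (1 - α) * n ≤ (1 - α) * ((1 + b) * p) := by gcongr
      have h2 : (1 - α) * (b * n) ≤ (1 - α) * k := by gcongr
      have h3 : 0 ≤ b * ((1 - α) * k) := by positivity
      linarith
    have := le_of_mul_le_mul_left h1 (by linarith)
    linarith
  refine ⟨⟨?_, ?_⟩, ⟨?_, ?_, ?_, ?_⟩, ⟨?_, ?_⟩, ⟨?_, ?_⟩⟩
  · have h1 : b ^ 2 * n ≤ 1 / 4 * n := by gcongr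
    have h2 : (707 / 1000) * n ≤ α * n := by gcongr
    linarith
  · linarith
  · have : b ^ 2 * n ≤ b * n := by gcongr
    linarith
  · linarith
  · linarith
  · linarith
  · have h1 : a ≤ b * k := by
      have h3 : b * (p - k) ≤ b * (b * k) := by
        have : b * p ≤ b * k + b * (b * k) := by
          calc b * p ≤ b * (α * n) := by gcongr
            _ = α * (b * n) := by ring
            _ ≤ α * k := by gcongr
            _ = _ := by rw [hα]; ring
        linarith
      have := le_of_mul_le_mul_left h3 (by linarith)
      linarith
    have h2 : (α - β) * a ≤ b ^ 2 * (b * k) := mul_le_mul hab h1 ha0.le (by positivity)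
    have h3 : b ^ 2 * (b * k) ≤ (1 - α) * (b * k) := by gcongr
    have h4 : b * ((1 - α) * k) ≤ β * f := mul_le_mul hbβ hf3 (by positivity) (by linarith)
    linarith
  · have h1 : (α - β) * f ≤ (1 - α) * (β * p) := by
      refine mul_le_mul (by linarith) hf' hf0.le h1α
    have h3 : β * ((1 - α) * p) ≤ β * a := by gcongr
    linarith
  · have h1 : (α - β) * g ≤ b ^ 2 * (β * n) := by
      refine mul_le_mul hab (hg'.trans ?_) hg0.le (by positivity)
      gcongr
      linarith [mul_le_mul_of_nonneg_right (show α ≤ 1 by linarith) hn0.le]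
    have h2 : b ^ 2 * (β * n) ≤ (1 - α) * (β * n) := by gcongr
    have h3 : β * ((1 - α) * n) ≤ β * d := by gcongr
    linarith
  · have hβα := h.β_le
    -- The goal is `(α - β) * d ≤ β * g`. Two lower bounds for `g` are available, `k - β * p` and
    -- `(1 - α) * k`, which agree when `β * p = α * k`. For fixed `k` this crossover value of `p` is
    -- the worst case, and `key` is the required inequality there.
    have key : 0 ≤ β ^ 2 * b * (1 - α) - (α - β) * (β - α * b) := by
      have : β ^ 2 * b * (1 - α) - (α - β) * (β - α * b) =
        (β - b) * ((1 + b) * ((1 - b ^ 2) * β - α * b)) := by rw [hα]; ring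
      rw [this]
      have : 0 ≤ (1 - b ^ 2) * β - α * b := by
        have h1 : (1 - b ^ 2) * b ≤ (1 - b ^ 2) * β := by gcongr; linarith
        have h2 : α * b ≤ (1 - b ^ 2) * b := by gcongr; linarith
        linarith
      have : 0 ≤ β - b := by linarith
      positivity
    have hkd : b * d ≤ k - b * p := by rw [hn] at hy; linarith
    have hαβ : 0 ≤ α - β := by linarith
    have hgp : k - β * p ≤ g := by linarith
    have main : (α - β) * (k - b * p) ≤ β * b * g := by
      -- Before the crossover the slack decreases in `p`, because `β ^ 2 + β ≥ b ^ 2 + b = α`; after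
      -- it, the lower bound for `g` is constant in `p` and the slack increases.
      rcases le_total (β * p) (α * k) with hle | hle
      · have h1 : β * ((α - β) * (k - b * p)) ≤ β * (β * b * (k - β * p)) := by
          have hco : 0 ≤ b * (β ^ 2 + β - α) := by
            have : b ^ 2 ≤ β ^ 2 := by gcongr
            exact mul_nonneg hb0.le (by linarith)
          linarith [mul_nonneg hco (sub_nonneg.2 hle), mul_nonneg key hk0.le]
        have h2 := le_of_mul_le_mul_left h1 hβ0
        have : β * b * (k - β * p) ≤ β * b * g := by gcongr
        linarith
      · have h1 : β * ((α - β) * (k - b * p)) ≤ β * (β * b * ((1 - α) * k)) := by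
          have : (α - β) * b * (α * k) ≤ (α - β) * b * (β * p) := by gcongr
          have := mul_nonneg key hk0.le
          linarith
        have h2 := le_of_mul_le_mul_left h1 hβ0
        have : β * b * ((1 - α) * k) ≤ β * b * g := by gcongr
        linarith
    have h1 : b * ((α - β) * d) ≤ b * (β * g) := by
      have : (α - β) * (b * d) ≤ (α - β) * (k - b * p) := by gcongr
      linarith
    have := le_of_mul_le_mul_left h1 hb0
    linarith

/-- A double rotation triggered by a very heavy grandchild does not increase the weight of the
heaviest child. -/
theorem doubleRot_gc_le {α β v y b g k p d n : ℝ} (h : Admissible α β v y b)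
    (hn : n = p + d) (hn0 : 0 < n) (hkp : k ≤ α * p) (hg' : g ≤ β * p) (hy : y * n ≤ k) :
    g + d ≤ p := by
  have hα1 := h.α_ge; have hβ9 := h.β_le'
  -- Cancelling `α` gives `n ≤ (2 - β) * p`, that is `β * p + d ≤ p`, and `g ≤ β * p`.
  have h1 : α * n ≤ α * ((2 - β) * p) := by
    calc α * n ≤ (2 - β) * y * n := mul_le_mul_of_nonneg_right h.le_y hn0.le
      _ = (2 - β) * (y * n) := by ring
      _ ≤ (2 - β) * (α * p) := mul_le_mul_of_nonneg_left (hy.trans hkp) (by linarith)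
      _ = _ := by ring
  have := le_of_mul_le_mul_left h1 (by linarith)
  linarith

/-- Effect of a simple rotation triggered by a heavy child. -/
theorem simpleRot_c {α β v y b a e p d n : ℝ} (h : Admissible α β v y b)
    (hpe : p = a + e) (hn : n = p + d) (he0 : 0 < e) (hd0 : 0 < d)
    (ha : a ≤ α * p) (hp : p ≤ 3 / 4 * n) (hp' : v * n ≤ p) (hav : (1 - v) * n ≤ a) :
    (a ≤ α * n ∧ e + d ≤ α * n) ∧ (e ≤ α * (e + d) ∧ d ≤ α * (e + d)) ∧ d ≤ a := by
  have hα1 := h.α_ge; have hα2 := h.α_le; have hv := h.v_le; have hv7 := h.v_ge_seven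
  have hn0 : 0 < n := by linarith
  have hp0 : 0 < p := by linarith
  have hα0 : 0 < α := by linarith
  have h1α : 0 ≤ 1 - α := by linarith
  have e3 : (1 - α) * p ≤ e := by linarith
  have p7 : 7 / 10 * n ≤ p := le_trans (by gcongr) hp'
  have vn : v * n ≤ α * n := by gcongr
  have vn' : v * n ≤ 3 / 4 * n := by gcongr; linarith
  refine ⟨⟨?_, ?_⟩, ⟨?_, ?_⟩, ?_⟩
  · exact ha.trans (by gcongr; linarith)
  · linarith
  · have h1 : (1 - α) * e ≤ (1 - 707 / 1000) * (1 / 2 * n) := by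
      gcongr
      linarith
    have h2 : 707 / 1000 * (1 / 4 * n) ≤ α * d := by gcongr; linarith
    linarith
  · have h1 : (1 - α) * d ≤ (1 - α) * (α * p) := by
      gcongr
      have : 707 / 1000 * p ≤ α * p := by gcongr
      linarith
    have h2 : α * ((1 - α) * p) ≤ α * e := by gcongr
    linarith
  · linarith

/-- Effect of a double rotation triggered by a heavy child. -/
theorem doubleRot_c {α β v y b a f g k p d n : ℝ} (h : Admissible α β v y b)
    (hk : k = f + g) (hpe : p = a + k) (hn : n = p + d)
    (ha0 : 0 < a) (hf0 : 0 < f) (hg0 : 0 < g) (hd0 : 0 < d)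
    (hkp : k ≤ α * p) (hf : f ≤ α * k) (hg : g ≤ α * k)
    (hp : p ≤ 3 / 4 * n) (hp' : v * n ≤ p) (hav : a ≤ (1 - v) * n) :
    (a + f ≤ α * n ∧ g + d ≤ α * n) ∧ (a ≤ α * (a + f) ∧ f ≤ α * (a + f)) ∧
    (g ≤ α * (g + d) ∧ d ≤ α * (g + d)) ∧ g + d ≤ p := by
  have hα1 := h.α_ge; have hα2 := h.α_le; have hv := h.v_le; have hv7 := h.v_ge_seven
  have hn0 : 0 < n := by linarith
  have hp0 : 0 < p := by linarith
  have hk0 : 0 < k := by linarith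
  have hα0 : 0 < α := by linarith
  have h1α : 0 ≤ 1 - α := by linarith
  have a3 : (1 - α) * p ≤ a := by linarith
  have f3 : (1 - α) * k ≤ f := by linarith
  have g3 : (1 - α) * k ≤ g := by linarith
  have p7 : 7 / 10 * n ≤ p := le_trans (by gcongr) hp'
  have vn7 : 7 / 10 * n ≤ v * n := by gcongr
  have αn7 : 707 / 1000 * n ≤ α * n := by gcongr
  have k3 : (2 * v - 1) * n ≤ k := by linarith
  -- This bounds both `a` and `d` by `α * k`. It is where `v ≥ (1 + α) / (1 + 2 * α)` is needed,
  -- being equivalent to `1 - v ≤ α * (2 * v - 1)`.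
  have vk : (1 - v) * n ≤ α * k := by
    have h1 : α * ((2 * v - 1) * n) ≤ α * k := by gcongr
    have h2 : (1 - v) * n ≤ α * (2 * v - 1) * n := by
      gcongr
      linarith [h.v_ge]
    linarith
  have αk : α * k ≤ α ^ 2 * p := by
    calc α * k ≤ α * (α * p) := by gcongr
      _ = _ := by ring
  have αk' : α ^ 2 * p ≤ 9 / 16 * p := by
    gcongr
    nlinarith only [hα1, hα2]
  refine ⟨⟨?_, ?_⟩, ⟨?_, ?_⟩, ⟨?_, ?_⟩, ?_⟩
  · have : 1 / 4 * k ≤ (1 - α) * k := by gcongr; linarith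
    linarith
  · linarith
  · have : (1 - α) * a ≤ (1 - α) * (α * k) := by gcongr; linarith
    have : α * ((1 - α) * k) ≤ α * f := by gcongr
    linarith
  · have : (1 - α) * f ≤ (1 - α) * (α * p) := by
      gcongr
      refine (hf.trans αk).trans ?_
      gcongr
      nlinarith only [hα1, hα2]
    have : α * ((1 - α) * p) ≤ α * a := by gcongr
    linarith
  · have h1 : (1 - α) * g ≤ (1 - 707 / 1000) * (α * (α * (3 / 4 * n))) := by
      gcongr
      exact (hg.trans αk).trans (by rw [pow_two, mul_assoc]; gcongr)
    have h2 : α * (1 / 4 * n) ≤ α * d := by gcongr; linarith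
    have h3 : α * (α * n) ≤ 3 / 4 * (α * n) := by gcongr
    have h4 : 0 < α * n := by positivity
    linarith
  · have : (1 - α) * d ≤ (1 - α) * (α * k) := by gcongr; linarith
    have : α * ((1 - α) * k) ≤ α * g := by gcongr
    linarith
  · linarith

/-! ### Inequalities for rotations at the root of a tree of weight at least 31 -/

namespace Admissible

variable {α β v y b n : ℝ}

/-- With `b ≥ 0.478` this requires `0.017 * n ≥ 0.522`, which holds from `n = 31` on but fails for
`n = 30`: this fixes the size from which rebalancing is used here. -/
theorem threshold_ge (h : Admissible α β v y b) (n31 : 31 ≤ n) :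
    461 / 1000 * n ≤ b * (n + 1) - 1 := by
  have : 239 / 500 * (n + 1) ≤ b * (n + 1) := by have := h.b_ge; gcongr
  linarith

/-- Children of grandchildren weigh at most `α * (β * n)`; since `27/64 < 461/1000`, they stay below
the threshold of `threshold_ge` when they become grandchildren. -/
theorem α_mul_β_le (h : Admissible α β v y b) (hn : 0 ≤ n) : α * (β * n) ≤ 27 / 64 * n := by
  have := h.β_le; have := h.α_cube_le; have := h.α_ge
  calc α * (β * n) ≤ α * (α ^ 2 * n) := by gcongr
    _ = α ^ 3 * n := by ring
    _ ≤ _ := by gcongr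

theorem α_mul_one_sub_ge (h : Admissible α β v y b) : 3 / 16 ≤ α * (1 - α) := by
  have := h.α_ge; have := h.α_le
  nlinarith

end Admissible

/-- Effect, on a large tree, of a simple rotation triggered by a heavy child. -/
theorem simpleRot_rc {α β v y b a e p d n : ℝ} (h : Admissible α β v y b)
    (hpe : p = a + e) (hn : n = p + d) (n31 : 31 ≤ n)
    (ha : a ≤ α * p) (haβ : a ≤ β * n) (hp : p ≤ α * n) (hp' : α * (n - 1) ≤ p)
    (hav : (1 - v) * n + v ≤ a) :
    (a ≤ α * (n - 1) ∧ e + d ≤ α * (n - 1)) ∧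
    (α * a ≤ b * (n + 1) - 1 ∧ e ≤ b * (n + 1) - 1 ∧ d ≤ b * (n + 1) - 1) ∧
    (e ≤ 3 / 4 * (e + d) ∧ d ≤ 3 / 4 * (e + d)) ∧ d ≤ a := by
  have hα1 := h.α_ge; have hα2 := h.α_le; have hv := h.v_le; have hv7 := h.v_ge_seven
  have hθ := h.threshold_ge n31
  have hαβ := h.α_mul_β_le (n := n) (by linarith)
  have hα0 : 0 < α := by linarith
  have h1α : 0 ≤ 1 - α := by linarith
  have e3 : (1 - α) * p ≤ e := by linarith
  have αv : v * (n - 1) ≤ α * (n - 1) := by gcongr; linarith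
  have αn : α * n ≤ 3 / 4 * n := by gcongr
  have αn' : 707 / 1000 * (n - 1) ≤ α * (n - 1) := by gcongr; linarith
  refine ⟨⟨?_, ?_⟩, ⟨?_, ?_, ?_⟩, ⟨?_, ?_⟩, ?_⟩
  · have : β * n ≤ 9 / 16 * n := by have := h.β_le'; gcongr
    linarith
  · linarith
  · have : α * a ≤ α * (β * n) := by gcongr
    linarith
  · have hb := h.b_le; have hb1 := h.b_ge
    have : (2 * α - 1) * n ≤ b * n := by
      gcongr
      linarith [h.b_sq_le, h.α_eq]
    linarith
  · linarith
  · linarith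
  · have h1 : 3 / 16 * (n - 1) ≤ (1 - α) * (α * (n - 1)) := by
      have := h.α_mul_one_sub_ge
      calc 3 / 16 * (n - 1) ≤ α * (1 - α) * (n - 1) := by gcongr; linarith
        _ = _ := by ring
    have h2 : (1 - α) * (α * (n - 1)) ≤ (1 - α) * p := by gcongr
    linarith
  · linarith

/-- Effect, on a large tree, of a double rotation triggered by a heavy child. -/
theorem doubleRot_rc {α β v y b a f g k p d n : ℝ} (h : Admissible α β v y b)
    (hk : k = f + g) (hpe : p = a + k) (hn : n = p + d) (n31 : 31 ≤ n)
    (hkp : k ≤ α * p) (hkβ : k ≤ β * n) (hf : f ≤ α * k) (hg : g ≤ α * k)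
    (hp : p ≤ α * n) (hp' : α * (n - 1) ≤ p) (hav : a ≤ (1 - v) * n + v) :
    (a + f ≤ α * (n - 1) ∧ g + d ≤ α * (n - 1)) ∧
    (a ≤ b * (n + 1) - 1 ∧ f ≤ b * (n + 1) - 1 ∧ g ≤ b * (n + 1) - 1 ∧ d ≤ b * (n + 1) - 1) ∧
    (a ≤ 3 / 4 * (a + f) ∧ f ≤ 3 / 4 * (a + f)) ∧
    (g ≤ 3 / 4 * (g + d) ∧ d ≤ 3 / 4 * (g + d)) := by
  have hα1 := h.α_ge; have hα2 := h.α_le; have hv := h.v_le; have hv7 := h.v_ge_seven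
  have hθ := h.threshold_ge n31
  have hαβ := h.α_mul_β_le (n := n) (by linarith)
  have hα0 : 0 < α := by linarith
  have h1α : 0 ≤ 1 - α := by linarith
  have a3 : (1 - α) * p ≤ a := by linarith
  have f3 : (1 - α) * k ≤ f := by linarith
  have g3 : (1 - α) * k ≤ g := by linarith
  have αv : v * (n - 1) ≤ α * (n - 1) := by gcongr; linarith
  have v7 : 7 / 10 * (n - 1) ≤ v * (n - 1) := by gcongr; linarith
  have αn : α * n ≤ 3 / 4 * n := by gcongr
  have αn' : 707 / 1000 * (n - 1) ≤ α * (n - 1) := by gcongr; linarith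
  have αk : α * k ≤ α * (β * n) := by gcongr
  have hp0 : 0 ≤ p := le_trans (mul_nonneg hα0.le (by linarith)) hp'
  have hd : d ≤ (1 - v) * n + v := by linarith
  have sq : (α - 707 / 1000) * (3 / 4 - α) ≥ 0 := mul_nonneg (by linarith) (by linarith)
  -- The left side bounds `a` and `d`, while `f` and `g` are at least `(1 - α) * k`, so this yields
  -- every bound of ratio `3/4` except that on `f`. Here `k ≥ (α + v - 1) * (n - 1) - 1`, and the
  -- affine lower bound on `v` turns the claim into a quadratic inequality in `α`, settled by `sq`.
  have key : (1 - v) * n + v ≤ 3 * ((1 - α) * k) := by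
    have h1 : (1 - α) * (((43 / 25) * α - 502 / 625) * (n - 1) - 1) ≤ (1 - α) * k := by
      gcongr
      have : (18 / 25 * α + 123 / 625) * (n - 1) ≤ v * (n - 1) := by
        gcongr
        · linarith
        · exact h.v_ge'
      linarith
    have h2 : (18 / 25 * α + 123 / 625) * (n - 1) ≤ v * (n - 1) := by
      gcongr
      · linarith
      · exact h.v_ge'
    have h3 := mul_nonneg sq (show 0 ≤ n - 1 by linarith)
    nlinarith only [h1, h2, h3, hα1, hα2, n31, mul_nonneg (sub_nonneg.2 hα1) (sub_nonneg.2 n31),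
      mul_nonneg (sub_nonneg.2 hα2) (sub_nonneg.2 n31)]
  refine ⟨⟨?_, ?_⟩, ⟨?_, ?_, ?_, ?_⟩, ⟨?_, ?_⟩, ⟨?_, ?_⟩⟩
  · have h1 : (1 - α) * a ≤ (1 - 707 / 1000) * (3 / 10 * (n - 1) + 1) := by
      gcongr
      · linarith only [a3, mul_nonneg h1α hp0]
      · linarith
    have h2 : α * p ≤ α * (α * n) := by gcongr
    have h3 : α * (α * n) ≤ 3 / 4 * (α * n) := by gcongr
    nlinarith
  · have : 2 * α ≤ (2 * α - 1 - α * β) * n := by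
      have h1 : α * β ≤ α * α ^ 2 := by have := h.β_le; gcongr
      have h2 : 6 / 100 ≤ 2 * α - 1 - α * β := by nlinarith
      nlinarith
    linarith
  · linarith
  · linarith
  · linarith
  · linarith
  · linarith
  · have : α * k ≤ α * (α * p) := by gcongr
    have : α * (α * p) ≤ 3 * ((1 - α) * p) := by
      have : α * (α * p) ≤ 3 / 4 * (3 / 4 * p) := by gcongr
      have : 1 / 4 * p ≤ (1 - α) * p := by gcongr; linarith
      linarith
    linarith
  · linarith
  · linarith

/-- Effect, on a large tree, of a simple rotation triggered by a heavy grandchild. -/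
theorem simpleRot_rgc {α β v y b a e p d n : ℝ} (h : Admissible α β v y b)
    (hpe : p = a + e) (hn : n = p + d) (n31 : 31 ≤ n)
    (ha : a ≤ α * p) (haβ : a ≤ β * n) (hp : p ≤ α * (n - 1))
    (hay : b * (n + 1) - 1 ≤ a) :
    (α * a ≤ b * (n + 1) - 1 ∧ e ≤ b * (n + 1) - 1 ∧ d ≤ b * (n + 1) - 1) ∧
    (e ≤ 3 / 4 * (e + d) ∧ d ≤ 3 / 4 * (e + d)) ∧ d ≤ a := by
  have hα1 := h.α_ge; have hα2 := h.α_le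
  have hθ := h.threshold_ge n31
  have hαβ := h.α_mul_β_le (n := n) (by linarith)
  have hp0 : 0 ≤ p := by
    by_contra! hc
    nlinarith
  have hα0 : 0 < α := by linarith
  have αp : α * p ≤ 3 / 4 * p := by gcongr
  have αn : α * (n - 1) ≤ 3 / 4 * (n - 1) := by gcongr; linarith
  have αa : α * a ≤ α * (β * n) := by gcongr
  refine ⟨⟨?_, ?_, ?_⟩, ⟨?_, ?_⟩, ?_⟩ <;> linarith

/-- Effect, on a large tree, of a double rotation triggered by a heavy grandchild. -/
theorem doubleRot_rgc {α β v y b a f g k p d n : ℝ} (h : Admissible α β v y b)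
    (hk : k = f + g) (hpe : p = a + k) (hn : n = p + d) (n31 : 31 ≤ n)
    (ha : a ≤ α * p) (hkp : k ≤ α * p) (hkβ : k ≤ β * n)
    (hf : f ≤ α * k) (hg : g ≤ α * k) (hp : p ≤ α * (n - 1))
    (hky : b * (n + 1) - 1 ≤ k) :
    (a ≤ b * (n + 1) - 1 ∧ f ≤ b * (n + 1) - 1 ∧ g ≤ b * (n + 1) - 1 ∧ d ≤ b * (n + 1) - 1) ∧
    (a ≤ 3 / 4 * (a + f) ∧ f ≤ 3 / 4 * (a + f)) ∧
    (g ≤ 3 / 4 * (g + d) ∧ d ≤ 3 / 4 * (g + d)) := by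
  have hα1 := h.α_ge; have hα2 := h.α_le
  have hθ := h.threshold_ge n31
  have hαβ := h.α_mul_β_le (n := n) (by linarith)
  have hp0 : 0 ≤ p := by
    by_contra! hc
    nlinarith
  have hα0 : 0 < α := by linarith
  have hk0 : 0 ≤ k := by linarith
  have αp : α * p ≤ 3 / 4 * p := by gcongr
  have αn : α * (n - 1) ≤ 3 / 4 * (n - 1) := by gcongr; linarith
  have αk : α * k ≤ α * (β * n) := by gcongr
  have αk' : α * k ≤ 3 / 4 * k := by gcongr
  refine ⟨⟨?_, ?_, ?_, ?_⟩, ⟨?_, ?_⟩, ⟨?_, ?_⟩⟩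
  · linarith
  · linarith
  · linarith
  · linarith
  · linarith
  · have h1 : α * k ≤ 3 / 4 * (α * p) := by
      calc α * k ≤ 3 / 4 * k := αk'
        _ ≤ _ := by gcongr
    linarith
  · linarith
  · have hb := h.b_ge; have hb' := h.b_le; have hαb := h.α_eq
    have hαα := h.α_mul_one_sub_ge
    -- The goal is `d ≤ 3 * g`. From `k ≤ α * p` and `g ≥ (1 - α) * k` it suffices that `α * n ≤ (1
    -- + 3 * α * (1 - α)) * k`, and `3 * α * (1 - α) ≥ 9/16`.
    have h1 : α * n ≤ 25 / 16 * (b * (n + 1) - 1) := by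
      have h2 : b ^ 2 * n ≤ (489 / 500 * b - 239 / 1000) * n := by
        gcongr
        linarith [mul_nonneg (sub_nonneg.2 hb) (sub_nonneg.2 hb')]
      have h3 := mul_nonneg (sub_nonneg.2 hb') (show 0 ≤ 831 / 2000 * n - 25 / 16 by linarith)
      rw [hαb]
      linarith
    have h2 : α * (n - p) ≤ α * (3 * g) := by
      have h3 : α * (3 * ((1 - α) * k)) ≤ α * (3 * g) := by
        gcongr
        linarith
      have h4 : 3 / 16 * k ≤ α * (1 - α) * k := by gcongr
      linarith
    have := le_of_mul_le_mul_left h2 hα0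
    linarith

/-- A double rotation triggered, in a large tree, by a heavy grandchild does not increase the
(integral) weight of the heaviest child. -/
theorem doubleRot_rgc_lt {α β v y b g k p d n : ℝ} (h : Admissible α β v y b)
    (hn : n = p + d) (n31 : 31 ≤ n) (hkp : k ≤ α * p) (hg' : g ≤ β * p)
    (hky : 1 / 2 ≤ β → β * (n - 1) < k) (hky' : β ≤ 1 / 2 → β * (n + 1) - 1 < k) :
    g + d < p + 1 := by
  have hα1 := h.α_ge; have hα2 := h.α_le; have hβ9 := h.β_le'; have hb := h.b_ge
  have hb' := h.b_le; have hbβ := h.b_le_β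
  have key : α * (n - 1) < α * ((2 - β) * p) := by
    have h1 : (2 - β) * k ≤ (2 - β) * (α * p) := by gcongr; linarith
    -- `R β` is a minimum whose active branch changes at `1/2`. Either way the aim is `n - 1 < (2 -
    -- β) * p`, which gives `β * p + d < p + 1`.
    rcases le_total (1 / 2) β with hβ | hβ
    · have h2 : (2 - β) * (β * (n - 1)) < (2 - β) * k := by
        have := hky hβ
        gcongr
        linarith
      have h3 : α * (n - 1) ≤ (2 - β) * β * (n - 1) := by
        gcongr
        · linarith
        · nlinarith only [hβ, hβ9, hα2]
      linarith
    · have h2 : (2 - β) * (β * (n + 1) - 1) < (2 - β) * k := by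
        have := hky' hβ
        gcongr
        linarith
      -- The excess of `(2 - β) * (β * (n + 1) - 1)` over `α * (n - 1)` is split into its value at
      -- `β = b`, which is `h4`, and its increment from `b` to `β`, which is `h3`.
      have h3 : 0 ≤ (β - b) * ((2 - β - b) * (n + 1) + 1) := by
        have : 0 ≤ (2 - β - b) * (n + 1) := mul_nonneg (by linarith) (by linarith)
        exact mul_nonneg (by linarith) (by linarith)
      have h4 : 0 ≤ (1 - 2 * b) * (b * n - 2) := by
        refine mul_nonneg (by linarith) ?_
        have : 239 / 500 * n ≤ b * n := by gcongr
        linarith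
      have h5 := h.α_eq
      rw [show α * (n - 1) = (b + b ^ 2) * (n - 1) by rw [h5]]
      linarith
  have := lt_of_mul_lt_mul_left key (by linarith)
  linarith

/-! ### Weights and the balance conditions -/

section Basic

variable {K : Type*}

@[simp] theorem weight_nil : weight (nil : BinaryTree K) = 1 := by simp [weight]

@[simp] theorem weight_node (x : K) (l r : BinaryTree K) :
    weight (node x l r) = weight l + weight r := by simp [weight]

theorem one_le_weight (t : BinaryTree K) : 1 ≤ weight t := by
  have := numLeaves_pos t
  unfold weight
  exact_mod_cast this

theorem weight_pos (t : BinaryTree K) : 0 < weight t := one_pos.trans_le (one_le_weight t)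

theorem weight_eq_numNodes (t : BinaryTree K) : weight t = t.numNodes + 1 := by
  rw [weight, numLeaves_eq_numNodes_succ]; push_cast; rfl

/-- Weights are integers, so an excess of less than `1` is no excess. In large trees the thresholds
lose up to one unit, and this recovers exact monotonicity of the heaviest child. -/
theorem weight_add_le_of_lt {s t u : BinaryTree K} (h : weight s + weight t < weight u + 1) :
    weight s + weight t ≤ weight u := by
  unfold weight at *
  norm_cast at *
  omega

theorem w₁_add_w₂ (t : BinaryTree K) : w₁ t + w₂ t = weight t := by
  cases t <;> simp [w₁, w₂]; norm_num

@[simp] theorem maxChild_node (x : K) (l r : BinaryTree K) :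
    maxChild (node x l r) = max (weight l) (weight r) := rfl

@[simp] theorem maxGrandchild_node (x : K) (l r : BinaryTree K) :
    maxGrandchild (node x l r) = max (maxChild l) (maxChild r) := rfl

theorem isBalanced_iff {α β : ℝ} (t : BinaryTree K) :
    IsBalanced α β t ↔ maxChild t ≤ α * weight t ∧ maxGrandchild t ≤ β * weight t := by
  rw [IsBalanced, balC, balGC, div_le_iff₀ (weight_pos t), div_le_iff₀ (weight_pos t)]

/-- Both children of the root satisfy `P`. -/
def Both (P : BinaryTree K → Prop) : BinaryTree K → Prop
  | nil => True
  | node _ l r => P l ∧ P r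

theorem Both.mono {P Q : BinaryTree K → Prop} (h : ∀ t, P t → Q t) {t : BinaryTree K}
    (ht : Both P t) : Both Q t := by
  cases t with
  | nil => trivial
  | node x l r => exact ⟨h _ ht.1, h _ ht.2⟩

/-- The two main sub-trees are `GCB(α, β)`-trees and the root has child-balance at most `c`. -/
def IsNearGCB (α β c : ℝ) (t : BinaryTree K) : Prop :=
  Both (IsGCB α β) t ∧ maxChild t ≤ c * weight t

theorem IsNearGCB.mono {α β c c' : ℝ} {t : BinaryTree K} (h : IsNearGCB α β c t) (hc : c ≤ c') :
    IsNearGCB α β c' t :=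
  ⟨h.1, h.2.trans (mul_le_mul_of_nonneg_right hc (weight_pos t).le)⟩

theorem IsGCB.both {α β : ℝ} {t : BinaryTree K} (h : IsGCB α β t) : Both (IsGCB α β) t := by
  cases t with
  | nil => trivial
  | node x l r => exact h.2

/-- The conventional children of an empty tree have balances `1/2` and `1/4`, so under these
hypotheses empty trees need no separate treatment. -/
theorem isGCB_iff_of_half_le {α β : ℝ} (hα : 1 / 2 ≤ α) (hβ : 1 / 4 ≤ β) {t : BinaryTree K} :
    IsGCB α β t ↔ IsNearGCB α β α t ∧ maxGrandchild t ≤ β * weight t := by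
  cases t with
  | nil =>
    simp only [IsGCB, IsNearGCB, Both, maxChild, maxGrandchild, w₁, w₂, w₁₁, w₁₂, w₂₁, w₂₂,
      weight_nil]
    simp only [max_self, true_and, true_iff]
    constructor <;> linarith
  | node x l r =>
    rw [IsGCB, isBalanced_iff, IsNearGCB, Both]
    tauto

end Basic

/-! ### Reduction by left-right symmetry -/

section Mirror

variable {K : Type*}

/-- The mirror image of a tree. -/
def mirror : BinaryTree K → BinaryTree K
  | nil => nil
  | node x l r => node x (mirror r) (mirror l)

@[simp] theorem weight_mirror (t : BinaryTree K) : weight (mirror t) = weight t := by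
  induction t with
  | nil => rfl
  | node x l r hl hr => simp [mirror, hl, hr, add_comm]

@[simp] theorem w₁_mirror (t : BinaryTree K) : w₁ (mirror t) = w₂ t := by
  cases t <;> simp [mirror, w₁, w₂]

@[simp] theorem w₂_mirror (t : BinaryTree K) : w₂ (mirror t) = w₁ t := by
  cases t <;> simp [mirror, w₁, w₂]

@[simp] theorem w₁₁_mirror (t : BinaryTree K) : w₁₁ (mirror t) = w₂₂ t := by
  cases t <;> simp [mirror, w₁₁, w₂₂]

@[simp] theorem w₁₂_mirror (t : BinaryTree K) : w₁₂ (mirror t) = w₂₁ t := by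
  cases t <;> simp [mirror, w₁₂, w₂₁]

@[simp] theorem maxChild_mirror (t : BinaryTree K) : maxChild (mirror t) = maxChild t := by
  simp [maxChild, max_comm]

@[simp] theorem maxGrandchild_mirror (t : BinaryTree K) :
    maxGrandchild (mirror t) = maxGrandchild t := by
  cases t with
  | nil => rfl
  | node x l r => simp [mirror, max_comm]

theorem both_mirror {P : BinaryTree K → Prop} (hP : ∀ t, P (mirror t) ↔ P t) (t : BinaryTree K) :
    Both P (mirror t) ↔ Both P t := by
  cases t with
  | nil => rfl
  | node x l r => simp [mirror, Both, hP, and_comm]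

@[simp] theorem isGCB_mirror {α β : ℝ} (t : BinaryTree K) :
    IsGCB α β (mirror t) ↔ IsGCB α β t := by
  induction t with
  | nil => rfl
  | node x l r hl hr =>
    have h : IsBalanced α β (node x (mirror r) (mirror l)) ↔ IsBalanced α β (node x l r) := by
      have := isBalanced_iff (α := α) (β := β) (mirror (node x l r))
      rw [maxChild_mirror, maxGrandchild_mirror, weight_mirror, ← isBalanced_iff] at this
      exact this
    simp [mirror, IsGCB, hl, hr, h, and_comm]

@[simp] theorem isNearGCB_mirror {α β c : ℝ} (t : BinaryTree K) :
    IsNearGCB α β c (mirror t) ↔ IsNearGCB α β c t := by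
  simp [IsNearGCB, both_mirror isGCB_mirror]

theorem SimpleRotMirror.mirror {t t' : BinaryTree K} (h : SimpleRotMirror t t') :
    SimpleRot (mirror t) (mirror t') := by
  cases h; exact .mk ..

theorem DoubleRotMirror.mirror {t t' : BinaryTree K} (h : DoubleRotMirror t t') :
    DoubleRot (mirror t) (mirror t') := by
  cases h; exact .mk ..

end Mirror

/-! ### General facts on the rebalancing steps -/

section Rotations

variable {K : Type*} {t t' : BinaryTree K}

theorem SimpleRot.weight_eq (h : SimpleRot t t') : weight t' = weight t := by
  cases h; simp; ring

theorem DoubleRot.weight_eq (h : DoubleRot t t') : weight t' = weight t := by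
  cases h; simp; ring

theorem SimpleRotMirror.weight_eq (h : SimpleRotMirror t t') : weight t' = weight t := by
  cases h; simp; ring

theorem DoubleRotMirror.weight_eq (h : DoubleRotMirror t t') : weight t' = weight t := by
  cases h; simp; ring

theorem SimpleRot.ne (h : SimpleRot t t') : t ≠ t' := by
  rintro rfl
  cases h

theorem DoubleRot.ne (h : DoubleRot t t') : t ≠ t' := by
  rintro rfl
  cases h

theorem SimpleRotMirror.ne (h : SimpleRotMirror t t') : t ≠ t' := by
  rintro rfl
  cases h

theorem DoubleRotMirror.ne (h : DoubleRotMirror t t') : t ≠ t' := by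
  rintro rfl
  cases h

theorem CBalancing.weight_eq {u v w x : ℝ} (h : CBalancing u v w x t t') :
    weight t' = weight t := by
  cases h with
  | case1 _ _ h => exact h.weight_eq
  | case2 _ _ h => exact h.weight_eq
  | case3 _ _ h => exact h.weight_eq
  | case4 _ _ h => exact h.weight_eq
  | case5 _ h => rw [h]

theorem GCBalancing.weight_eq {y z : ℝ} (h : GCBalancing y z t t') : weight t' = weight t := by
  cases h with
  | case1 _ h => exact h.weight_eq
  | case2 _ h => exact h.weight_eq
  | case3 _ h => exact h.weight_eq
  | case4 _ h => exact h.weight_eq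
  | case5 _ h => rw [h]

theorem OnSubtrees.weight_eq {S : BinaryTree K → BinaryTree K → Prop}
    (hS : ∀ s s', S s s' → weight s' = weight s) (h : OnSubtrees S t t') :
    weight t' = weight t := by
  cases h with
  | mk a l r l' r' hl hr => simp [hS _ _ hl, hS _ _ hr]

theorem CGCBalancing.weight_eq {u v y z : ℝ} (h : CGCBalancing u v y z t t') :
    weight t' = weight t := by
  cases h with
  | changed t₁ t₂ h₁ _ h₂ h₃ =>
    rw [h₃.weight_eq, h₂.weight_eq fun _ _ => GCBalancing.weight_eq, h₁.weight_eq]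
  | unchanged _ h₂ => exact h₂.weight_eq

theorem CBalancing.maxChild_le {u v w x : ℝ} (h : CBalancing u v w x t t) :
    maxChild t ≤ u * weight t + w := by
  cases h with
  | case1 _ _ h => exact absurd rfl h.ne
  | case2 _ _ h => exact absurd rfl h.ne
  | case3 _ _ h => exact absurd rfl h.ne
  | case4 _ _ h => exact absurd rfl h.ne
  | case5 h _ => exact h

theorem GCBalancing.maxGrandchild_le {y z : ℝ} (h : GCBalancing y z t t) :
    maxGrandchild t ≤ y * weight t + z := by
  cases h with
  | case1 _ h => exact absurd rfl h.ne
  | case2 _ h => exact absurd rfl h.ne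
  | case3 _ h => exact absurd rfl h.ne
  | case4 _ h => exact absurd rfl h.ne
  | case5 h _ => exact h

theorem GCBalancing.eq_of_maxGrandchild_le {y z : ℝ} (h : GCBalancing y z t t')
    (ht : maxGrandchild t ≤ y * weight t + z) : t' = t := by
  simp only [maxGrandchild, max_le_iff] at ht
  cases h with
  | case1 h _ => exact absurd h ht.1.1.not_gt
  | case2 h _ => exact absurd h ht.2.2.not_gt
  | case3 h _ => exact absurd h ht.1.2.not_gt
  | case4 h _ => exact absurd h ht.2.1.not_gt
  | case5 _ h => exact h

/-- A property of the outcome of a changing `C`-balancing step, up to mirror image, has to be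
checked only for rotations lifting the left child. -/
theorem CBalancing.rec_mirror {u v w x : ℝ} {P : BinaryTree K → BinaryTree K → Prop}
    (hP : ∀ s s', P (mirror s) (mirror s') → P s s')
    (hs : ∀ s s', w₁ s > u * weight s + w →
      w₁₁ s ≥ (1 - v) * weight s - x → SimpleRot s s' → P s s')
    (hd : ∀ s s', w₁ s > u * weight s + w →
      w₁₁ s < (1 - v) * weight s - x → DoubleRot s s' → P s s')
    (h : CBalancing u v w x t t') (ne : t ≠ t') : P t t' := by
  cases h with
  | case1 h h' rot => exact hs _ _ h h' rot
  | case2 h h' rot =>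
    exact hP _ _ (hs _ _ (by simpa using h) (by simpa using h') rot.mirror)
  | case3 h h' rot => exact hd _ _ h h' rot
  | case4 h h' rot =>
    exact hP _ _ (hd _ _ (by simpa using h) (by simpa using h') rot.mirror)
  | case5 _ same => exact absurd same.symm ne

/-- The analogue of `CBalancing.rec_mirror` for `GC`-balancing. -/
theorem GCBalancing.rec_mirror {y z : ℝ} {P : BinaryTree K → BinaryTree K → Prop}
    (hP : ∀ s s', P (mirror s) (mirror s') → P s s')
    (hs : ∀ s s', w₁₁ s > y * weight s + z → SimpleRot s s' → P s s')
    (hd : ∀ s s', w₁₂ s > y * weight s + z → DoubleRot s s' → P s s')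
    (h : GCBalancing y z t t') (ne : t ≠ t') : P t t' := by
  cases h with
  | case1 h rot => exact hs _ _ h rot
  | case2 h rot => exact hP _ _ (hs _ _ (by simpa using h) rot.mirror)
  | case3 h rot => exact hd _ _ h rot
  | case4 h rot => exact hP _ _ (hd _ _ (by simpa using h) rot.mirror)
  | case5 _ same => exact absurd same.symm ne

/-- The children keep their weights, so the child-balance of the root is unchanged; its
grandchildren are the children of the transformed sub-trees. This is why every local algorithm is
shown not to increase the heaviest child. -/
theorem OnSubtrees.outcome {S : BinaryTree K → BinaryTree K → Prop} {P Q : BinaryTree K → Prop}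
    (hS : ∀ s s', P s → S s s' → weight s' = weight s ∧ maxChild s' ≤ maxChild s ∧ Q s')
    (ht : Both P t) (h : OnSubtrees S t t') :
    weight t' = weight t ∧ maxChild t' = maxChild t ∧ maxGrandchild t' ≤ maxGrandchild t ∧
      Both Q t' := by
  cases h with
  | mk a l r l' r' hl hr =>
    obtain ⟨l1, l2, l3⟩ := hS _ _ ht.1 hl
    obtain ⟨r1, r2, r3⟩ := hS _ _ ht.2 hr
    refine ⟨by simp [l1, r1], by simp [l1, r1], ?_, l3, r3⟩
    simp only [maxGrandchild_node]
    exact max_le_max l2 r2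

end Rotations

/-! ### Building balanced trees from balanced sub-trees -/

section GCBTrees

variable {K : Type*} {α β v y b : ℝ} {t t' : BinaryTree K}

theorem IsGCB.bounds (h : Admissible α β v y b) (ht : IsGCB α β t) :
    maxChild t ≤ α * weight t ∧ maxGrandchild t ≤ β * weight t := by
  rw [isGCB_iff_of_half_le (by linarith [h.α_ge]) (by linarith [h.b_le_β, h.b_ge])] at ht
  exact ⟨ht.1.2, ht.2⟩

theorem IsGCB.isNearGCB (h : Admissible α β v y b) (ht : IsGCB α β t) : IsNearGCB α β α t :=
  ⟨ht.both, (ht.bounds h).1⟩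

theorem isNearGCB_node {c : ℝ} {x : K} {l r : BinaryTree K} (hl : IsGCB α β l) (hr : IsGCB α β r)
    (cl : weight l ≤ c * (weight l + weight r)) (cr : weight r ≤ c * (weight l + weight r)) :
    IsNearGCB α β c (node x l r) :=
  ⟨⟨hl, hr⟩, by simpa using ⟨cl, cr⟩⟩

/-- Sufficient conditions for a tree to be a `GCB(α, β)`-tree, its sub-trees being such trees. -/
theorem isGCB_node (h : Admissible α β v y b) {x : K} {l r : BinaryTree K}
    (hl : IsGCB α β l) (hr : IsGCB α β r) (cl : α * weight l ≤ β * (weight l + weight r))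
    (cr : α * weight r ≤ β * (weight l + weight r)) : IsGCB α β (node x l r) := by
  have hα : 0 < α := by linarith [h.α_ge]
  -- The single pair of hypotheses covers both balances: the child condition follows because `β ≤ α
  -- ^ 2`, and the grandchild condition because the children are themselves child-balanced.
  have hS : β * (weight l + weight r) ≤ α * (α * (weight l + weight r)) := by
    have := weight_pos l; have := weight_pos r; have := h.β_le
    rw [← mul_assoc, ← pow_two]
    gcongr
  refine ⟨(isBalanced_iff _).2 ⟨?_, ?_⟩, hl, hr⟩
  · simp only [maxChild_node, weight_node, max_le_iff]
    exact ⟨le_of_mul_le_mul_left (cl.trans hS) hα, le_of_mul_le_mul_left (cr.trans hS) hα⟩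
  · simp only [maxGrandchild_node, weight_node, max_le_iff]
    exact ⟨(hl.bounds h).1.trans cl, (hr.bounds h).1.trans cr⟩

/-- Weights around the lifted nodes of a simple rotation. -/
theorem SimpleRot.weights (h : Admissible α β v y b) (hb : Both (IsGCB α β) t)
    (rot : SimpleRot t t') : ∃ (x₁ x : K) (A B C : BinaryTree K),
      t' = node x₁ A (node x B C) ∧ IsGCB α β A ∧ IsGCB α β B ∧ IsGCB α β C ∧
      w₁ t = weight A + weight B ∧ w₁₁ t = weight A ∧ w₂ t = weight C ∧
      weight t = weight A + weight B + weight C ∧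
      weight A ≤ α * (weight A + weight B) := by
  cases rot with
  | mk x x₁ A B C =>
    have := (hb.1.bounds h).1
    simp only [maxChild_node, weight_node, max_le_iff] at this
    exact ⟨x₁, x, A, B, C, rfl, hb.1.2.1, hb.1.2.2, hb.2, by simp [w₁], by simp [w₁₁, w₁],
      by simp [w₂], by simp, this.1⟩

/-- Weights around the lifted nodes of a double rotation. -/
theorem DoubleRot.weights (h : Admissible α β v y b) (hb : Both (IsGCB α β) t)
    (rot : DoubleRot t t') : ∃ (x₁₂ x₁ x : K) (A B C D : BinaryTree K),
      t' = node x₁₂ (node x₁ A B) (node x C D) ∧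
      (IsGCB α β A ∧ IsGCB α β B ∧ IsGCB α β C ∧ IsGCB α β D) ∧
      w₁ t = weight A + (weight B + weight C) ∧ w₁₁ t = weight A ∧ w₁₂ t = weight B + weight C ∧
      w₂ t = weight D ∧ weight t = weight A + (weight B + weight C) + weight D ∧
      (weight A ≤ α * (weight A + (weight B + weight C)) ∧
        weight B + weight C ≤ α * (weight A + (weight B + weight C))) ∧
      (weight B ≤ α * (weight B + weight C) ∧ weight C ≤ α * (weight B + weight C)) ∧
      (weight B ≤ β * (weight A + (weight B + weight C)) ∧
        weight C ≤ β * (weight A + (weight B + weight C))) := by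
  cases rot with
  | mk x x₁ x₁₂ A B C D =>
    have h1 := hb.1.bounds h
    have h2 := (hb.1.2.2.bounds h).1
    simp only [maxChild_node, maxGrandchild_node, weight_node, max_le_iff] at h1 h2
    exact ⟨x₁₂, x₁, x, A, B, C, D, rfl, ⟨hb.1.2.1, hb.1.2.2.2.1, hb.1.2.2.2.2, hb.2⟩,
      by simp [w₁], by simp [w₁₁, w₁], by simp [w₁₂, w₂], by simp [w₂], by simp, h1.1, h2, h1.2.2⟩

end GCBTrees

/-! ### Correctness of GC- and CGC-balancing -/

section LocalBalancing

variable {K : Type*} {α β v y b : ℝ} {t t' : BinaryTree K}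

/-- `GC`-balancing makes a `GCB(α, β)`-tree of a tree that is only child-balanced at its root, and
does not increase the weight of the heaviest child. -/
theorem GCBalancing.isGCB (h : Admissible α β v y b) (ht : IsNearGCB α β α t)
    (hgc : GCBalancing y 0 t t') : IsGCB α β t' ∧ maxChild t' ≤ maxChild t := by
  have hα := h.α_ge
  have hβ := h.b_le_β
  have hb := h.b_ge
  have hby := h.b_le_y
  by_cases ne : t = t'
  · subst ne
    refine ⟨?_, le_rfl⟩
    rw [isGCB_iff_of_half_le (by linarith) (by linarith)]
    refine ⟨ht, hgc.maxGrandchild_le.trans ?_⟩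
    rw [add_zero]
    exact mul_le_mul_of_nonneg_right h.y_le (weight_pos t).le
  · refine GCBalancing.rec_mirror (P := fun s s' ↦ IsNearGCB α β α s →
      IsGCB α β s' ∧ maxChild s' ≤ maxChild s) ?_ ?_ ?_ hgc ne ht
    · intro s s'
      simp
    · intro s s' hy rot hs
      obtain ⟨x₁, x, A, B, C, rfl, hA, hB, hC, e₁, e₁₁, e₂, e, hA'⟩ := rot.weights h hs.1
      have hc := hs.2
      rw [e₁₁] at hy
      have hW := weight_pos s
      have hyb : b * weight s ≤ y * weight s := by gcongr
      obtain ⟨⟨c1, c2, c3, c4⟩, ⟨c5, c6⟩, c7⟩ := simpleRot_gc h rfl e (weight_pos A) (weight_pos B)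
        (weight_pos C) hA' (by rw [← e₁]; exact (le_max_left _ _).trans hc) (by linarith)
      have hp : w₁ s ≤ α * weight s := (le_max_left _ _).trans hc
      have hBC := isGCB_node h (x := x) hB hC c5 c6
      have hB0 := weight_pos B
      have e' : weight A + (weight B + weight C) = weight s := by rw [e]; ring
      refine ⟨⟨(isBalanced_iff _).2 ⟨?_, ?_⟩, hA, hBC⟩, ?_⟩
      · simp only [maxChild_node, weight_node, max_le_iff, e']
        exact ⟨by linarith, c1⟩
      · simp only [maxGrandchild_node, maxChild_node, weight_node, max_le_iff, e']
        exact ⟨(hA.bounds h).1.trans c2, c3, c4⟩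
      · simp only [maxChild_node, weight_node]
        refine max_le ?_ ?_ <;> refine le_trans ?_ (le_max_left _ _) <;> linarith
    · intro s s' hy rot hs
      obtain ⟨x₁₂, x₁, x, A, B, C, D, rfl, ⟨hA, hB, hC, hD⟩, e₁, e₁₁, e₁₂, e₂, e, ⟨hA', hk⟩,
        ⟨hB', hC'⟩, hB'', hC''⟩ := rot.weights h hs.1
      have hc := hs.2
      rw [e₁₂] at hy
      have hW := weight_pos s
      have hyb : b * weight s ≤ y * weight s := by gcongr
      have hp : w₁ s ≤ α * weight s := (le_max_left _ _).trans hc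
      obtain ⟨⟨c1, c2⟩, ⟨c3, c4, c5, c6⟩, ⟨c7, c8⟩, c9, c10⟩ := doubleRot_gc h rfl rfl e
        (weight_pos A) (weight_pos B) (weight_pos C) (weight_pos D) hk hB' hC' hB'' hC''
        (by linarith) (by linarith)
      have c11 := doubleRot_gc_le h e hW hk hC'' (by linarith)
      have hAB := isGCB_node h (x := x₁) hA hB c7 c8
      have hCD := isGCB_node h (x := x) hC hD c9 c10
      have hC0 := weight_pos C
      have e' : weight A + weight B + (weight C + weight D) = weight s := by rw [e]; ring
      refine ⟨⟨(isBalanced_iff _).2 ⟨?_, ?_⟩, hAB, hCD⟩, ?_⟩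
      · simp only [maxChild_node, weight_node, max_le_iff, e']
        exact ⟨c1, c2⟩
      · simp only [maxGrandchild_node, maxChild_node, weight_node, max_le_iff, e']
        exact ⟨⟨c3, c4⟩, c5, c6⟩
      · simp only [maxChild_node, weight_node]
        refine max_le ?_ ?_ <;> refine le_trans ?_ (le_max_left _ _) <;> linarith

/-- A changing `C`-balancing step makes the root and its children child-balanced. -/
theorem CBalancing.isNearGCB (h : Admissible α β v y b) (ht : IsNearGCB α β (3 / 4) t)
    (hc : CBalancing v v 0 0 t t') (ne : t ≠ t') :
    Both (IsNearGCB α β α) t' ∧ maxChild t' ≤ α * weight t' ∧ maxChild t' ≤ maxChild t := by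
  refine CBalancing.rec_mirror (P := fun s s' ↦ IsNearGCB α β (3 / 4) s →
    Both (IsNearGCB α β α) s' ∧ maxChild s' ≤ α * weight s' ∧ maxChild s' ≤ maxChild s)
    ?_ ?_ ?_ hc ne ht
  · intro s s'
    simp [both_mirror isNearGCB_mirror]
  · intro s s' hv hx rot hs
    obtain ⟨x₁, x, A, B, C, rfl, hA, hB, hC, e₁, e₁₁, e₂, e, hA'⟩ := rot.weights h hs.1
    rw [e₁, add_zero] at hv
    rw [e₁₁, sub_zero] at hx
    have hp : w₁ s ≤ 3 / 4 * weight s := (le_max_left _ _).trans hs.2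
    rw [e₁] at hp
    obtain ⟨⟨c1, c2⟩, ⟨c3, c4⟩, c5⟩ := simpleRot_c h rfl e (weight_pos B) (weight_pos C)
      hA' hp hv.le hx
    have hB0 := weight_pos B
    refine ⟨⟨hA.isNearGCB h, isNearGCB_node hB hC c3 c4⟩, ?_, ?_⟩
    · rw [rot.weight_eq]
      exact max_le c1 (by simpa [w₂] using c2)
    · simp only [maxChild_node, weight_node]
      refine max_le ?_ ?_ <;> refine le_trans ?_ (le_max_left _ _) <;> linarith
  · intro s s' hv hx rot hs
    obtain ⟨x₁₂, x₁, x, A, B, C, D, rfl, ⟨hA, hB, hC, hD⟩, e₁, e₁₁, e₁₂, e₂, e, ⟨hA', hk⟩,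
      ⟨hB', hC'⟩, hB'', hC''⟩ := rot.weights h hs.1
    rw [e₁, add_zero] at hv
    rw [e₁₁, sub_zero] at hx
    have hp : w₁ s ≤ 3 / 4 * weight s := (le_max_left _ _).trans hs.2
    rw [e₁] at hp
    obtain ⟨⟨c1, c2⟩, ⟨c3, c4⟩, ⟨c5, c6⟩, c7⟩ := doubleRot_c h rfl rfl e (weight_pos A)
      (weight_pos B) (weight_pos C) (weight_pos D) hk hB' hC' hp hv.le hx.le
    have hC0 := weight_pos C
    refine ⟨⟨isNearGCB_node hA hB c3 c4, isNearGCB_node hC hD c5 c6⟩, ?_, ?_⟩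
    · rw [rot.weight_eq]
      exact max_le (by simpa [w₁] using c1) (by simpa [w₂] using c2)
    · simp only [maxChild_node, weight_node]
      refine max_le ?_ ?_ <;> refine le_trans ?_ (le_max_left _ _) <;> linarith

/-- `CGC`-balancing makes a `GCB(α, β)`-tree of a tree whose root has child-balance at most `3/4`,
and does not increase the weight of the heaviest child. -/
theorem CGCBalancing.isGCB (h : Admissible α β v y b) (ht : IsNearGCB α β (3 / 4) t)
    (hcgc : CGCBalancing v v y y t t') :
    weight t' = weight t ∧ maxChild t' ≤ maxChild t ∧ IsGCB α β t' := by
  refine ⟨hcgc.weight_eq, ?_⟩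
  cases hcgc with
  | changed t₁ t₂ h₁ ne h₂ h₃ =>
    obtain ⟨a1, a2, a3⟩ := h₁.isNearGCB h ht ne
    obtain ⟨b1, b2, b3, b4⟩ := h₂.outcome (Q := IsGCB α β) (fun s s' hs hs' ↦
      have := hs'.isGCB h hs
      ⟨hs'.weight_eq, this.2, this.1⟩) a1
    obtain ⟨d1, d2⟩ := h₃.isGCB h ⟨b4, by rw [b1, b2]; exact a2⟩
    exact ⟨by linarith, d1⟩
  | unchanged h₁ h₂ =>
    have := h₁.maxChild_le
    rw [add_zero] at this
    obtain ⟨d1, d2⟩ := h₂.isGCB h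
      ⟨ht.1, this.trans (mul_le_mul_of_nonneg_right h.v_le (weight_pos t).le)⟩
    exact ⟨d2, d1⟩

end LocalBalancing

/-! ### Correctness of RCGC-balancing on large trees -/

section Rebalancing

variable {K : Type*} {α β v y b : ℝ} {t t' : BinaryTree K}

theorem R_of_half_le {r : ℝ} (hr : 1 / 2 ≤ r) : R r = -r := min_eq_left (by linarith)

/-- A lower bound for the thresholds used in the `GC`-balancing of a tree of weight `n`. -/
theorem Admissible.le_threshold (h : Admissible α β v y b) {r n : ℝ} (hr : b ≤ r) (hn : 1 ≤ n) :
    b * (n + 1) - 1 ≤ r * n + R r := by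
  have h1 : b * (n + 1) ≤ r * (n + 1) := by gcongr
  have h2 : b * (n - 1) ≤ r * (n - 1) := by gcongr
  have := h.b_le
  rw [R, ← sub_le_iff_le_add']
  exact le_min (by linarith) (by linarith)

/-- Outcome of a changing `C`-balancing step on a large `GCB(α, β)`-tree. -/
theorem CBalancing.outcome_large (h : Admissible α β v y b) (ht : IsGCB α β t)
    (h31 : 31 ≤ weight t) (hc : CBalancing α v (R α) (R v) t t') (ne : t ≠ t') :
    Both (IsNearGCB α β (3 / 4)) t' ∧ maxChild t' ≤ α * (weight t - 1) ∧
      maxChild t' ≤ maxChild t ∧ maxGrandchild t' ≤ b * (weight t + 1) - 1 := by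
  have hα := h.α_ge
  have hα' := h.α_le
  rw [R_of_half_le (by linarith), R_of_half_le (by linarith [h.v_ge_seven])] at hc
  refine CBalancing.rec_mirror (P := fun s s' ↦ IsGCB α β s → 31 ≤ weight s →
    Both (IsNearGCB α β (3 / 4)) s' ∧ maxChild s' ≤ α * (weight s - 1) ∧
      maxChild s' ≤ maxChild s ∧ maxGrandchild s' ≤ b * (weight s + 1) - 1)
    ?_ ?_ ?_ hc ne ht h31
  · intro s s'
    simp [both_mirror isNearGCB_mirror]
  · intro s s' hv hx rot hs h31
    obtain ⟨x₁, x, A, B, C, rfl, hA, hB, hC, e₁, e₁₁, e₂, e, hA'⟩ := rot.weights h hs.both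
    obtain ⟨hp, hq⟩ := hs.bounds h
    simp only [maxChild, maxGrandchild, max_le_iff] at hp hq
    rw [e₁] at hv hp
    rw [e₁₁] at hx hq
    obtain ⟨⟨c1, c2⟩, ⟨c3, c4, c5⟩, ⟨c6, c7⟩, c8⟩ := simpleRot_rc h rfl e h31 hA' hq.1.1 hp.1
      (by linarith) (by linarith)
    refine ⟨⟨(hA.isNearGCB h).mono hα', isNearGCB_node hB hC c6 c7⟩, ?_, ?_, ?_⟩
    · exact max_le c1 (by simpa [w₂] using c2)
    · have hB0 := weight_pos B
      simp only [maxChild_node, weight_node]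
      refine max_le ?_ ?_ <;> refine le_trans ?_ (le_max_left _ _) <;> linarith
    · simp only [maxGrandchild_node, maxChild_node, max_le_iff]
      exact ⟨(hA.bounds h).1.trans c3, c4, c5⟩
  · intro s s' hv hx rot hs h31
    obtain ⟨x₁₂, x₁, x, A, B, C, D, rfl, ⟨hA, hB, hC, hD⟩, e₁, e₁₁, e₁₂, e₂, e, ⟨hA', hk⟩,
      ⟨hB', hC'⟩, hB'', hC''⟩ := rot.weights h hs.both
    obtain ⟨hp, hq⟩ := hs.bounds h
    simp only [maxChild, maxGrandchild, max_le_iff] at hp hq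
    rw [e₁] at hv hp
    rw [e₁₁] at hx
    rw [e₁₂] at hq
    obtain ⟨⟨c1, c2⟩, ⟨c3, c4, c5, c6⟩, ⟨c7, c8⟩, c9, c10⟩ := doubleRot_rc h rfl rfl e h31 hk
      hq.1.2 hB' hC' hp.1 (by linarith) (by linarith)
    refine ⟨⟨isNearGCB_node hA hB c7 c8, isNearGCB_node hC hD c9 c10⟩, ?_, ?_, ?_⟩
    · exact max_le (by simpa [w₁] using c1) (by simpa [w₂] using c2)
    · simp only [maxChild_node, weight_node]
      refine max_le ?_ ?_ <;> refine le_trans ?_ (le_max_left _ _) <;> linarith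
    · simp only [maxGrandchild_node, maxChild_node, max_le_iff]
      exact ⟨⟨c3, c4⟩, c5, c6⟩

/-- Outcome of a changing `GC`-balancing step on a large `GCB(α, β)`-tree that is robustly
child-balanced. -/
theorem GCBalancing.outcome_large (h : Admissible α β v y b) (ht : IsGCB α β t)
    (h31 : 31 ≤ weight t) (hmax : maxChild t ≤ α * (weight t - 1))
    (hgc : GCBalancing β (R β) t t') (ne : t ≠ t') :
    Both (IsNearGCB α β (3 / 4)) t' ∧ maxChild t' ≤ maxChild t ∧
      maxGrandchild t' ≤ b * (weight t + 1) - 1 := by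
  have hα' := h.α_le
  refine GCBalancing.rec_mirror (P := fun s s' ↦ IsGCB α β s → 31 ≤ weight s →
    maxChild s ≤ α * (weight s - 1) →
    Both (IsNearGCB α β (3 / 4)) s' ∧ maxChild s' ≤ maxChild s ∧
      maxGrandchild s' ≤ b * (weight s + 1) - 1)
    ?_ ?_ ?_ hgc ne ht h31 hmax
  · intro s s'
    simp [both_mirror isNearGCB_mirror]
  · intro s s' hy rot hs h31 hmax
    have hθ := h.le_threshold h.b_le_β (show 1 ≤ weight s by linarith)
    obtain ⟨x₁, x, A, B, C, rfl, hA, hB, hC, e₁, e₁₁, e₂, e, hA'⟩ := rot.weights h hs.both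
    have hq := (hs.bounds h).2
    simp only [maxChild, maxGrandchild, max_le_iff] at hmax hq
    rw [e₁] at hmax
    rw [e₁₁] at hy hq
    obtain ⟨⟨c3, c4, c5⟩, ⟨c6, c7⟩, c8⟩ := simpleRot_rgc h rfl e h31 hA' hq.1.1 hmax.1
      (by linarith)
    refine ⟨⟨(hA.isNearGCB h).mono hα', isNearGCB_node hB hC c6 c7⟩, ?_, ?_⟩
    · have hB0 := weight_pos B
      simp only [maxChild_node, weight_node]
      refine max_le ?_ ?_ <;> refine le_trans ?_ (le_max_left _ _) <;> linarith
    · simp only [maxGrandchild_node, maxChild_node, max_le_iff]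
      exact ⟨(hA.bounds h).1.trans c3, c4, c5⟩
  · intro s s' hy rot hs h31 hmax
    have hθ := h.le_threshold h.b_le_β (show 1 ≤ weight s by linarith)
    obtain ⟨x₁₂, x₁, x, A, B, C, D, rfl, ⟨hA, hB, hC, hD⟩, e₁, e₁₁, e₁₂, e₂, e, ⟨hA', hk⟩,
      ⟨hB', hC'⟩, hB'', hC''⟩ := rot.weights h hs.both
    have hq := (hs.bounds h).2
    simp only [maxChild, maxGrandchild, max_le_iff] at hmax hq
    rw [e₁] at hmax
    rw [e₁₂] at hy hq
    obtain ⟨⟨c3, c4, c5, c6⟩, ⟨c7, c8⟩, c9, c10⟩ := doubleRot_rgc h rfl rfl e h31 hA' hk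
      hq.1.2 hB' hC' hmax.1 (by linarith)
    have c11 := doubleRot_rgc_lt h e h31 hk hC''
      (fun hβ ↦ by rw [R_of_half_le hβ] at hy; linarith)
      (fun hβ ↦ by rw [R, min_eq_right (by linarith)] at hy; linarith)
    rw [← weight_node x₁₂ B C, ← weight_node x₁ A] at c11
    have c12 := weight_add_le_of_lt c11
    simp only [weight_node] at c12
    refine ⟨⟨isNearGCB_node hA hB c7 c8, isNearGCB_node hC hD c9 c10⟩, ?_, ?_⟩
    · have hC0 := weight_pos C
      simp only [maxChild_node, weight_node]
      refine max_le ?_ ?_ <;> refine le_trans ?_ (le_max_left _ _) <;> linarith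
    · simp only [maxGrandchild_node, maxChild_node, max_le_iff]
      exact ⟨⟨c3, c4⟩, c5, c6⟩

theorem RCGCBalancing.weight_eq {u v y z : ℝ} (h : RCGCBalancing u v y z t t') :
    weight t' = weight t := by
  cases h with
  | changedC t₁ t₂ t₃ h₁ _ h₂ h₃ h₄ =>
    rw [h₄.weight_eq fun _ _ => CGCBalancing.weight_eq, h₃.weight_eq,
      h₂.weight_eq fun _ _ => CGCBalancing.weight_eq, h₁.weight_eq]
  | changedGC t₃ _ h₂ _ h₃ =>
    rw [h₃.weight_eq fun _ _ => CGCBalancing.weight_eq, h₂.weight_eq]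
  | unchanged _ _ same => rw [same]

/-- The two entries of the minimum `R β` are exactly the two robust grandchild conditions; for
children, `α ≥ 1/2` makes the condition with `weight t - 1` imply the other one. -/
theorem isRGCB_of_bounds (h : Admissible α β v y b) (hb : Both (IsGCB α β) t)
    (hc : maxChild t ≤ α * (weight t - 1)) (hg : maxGrandchild t ≤ β * weight t + R β) :
    IsRGCB α β t := by
  cases t with
  | nil => trivial
  | node x l r =>
    have hα := h.α_ge
    have h1 : R β ≤ -β := min_le_left _ _
    have h2 : R β ≤ β - 1 := min_le_right _ _
    exact ⟨⟨⟨by linarith, hc⟩, by linarith, by linarith⟩, hb.1, hb.2⟩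

/-- The `RCGC`-balancing algorithm makes a large `GCB(α, β)`-tree robust, and does not increase the
weight of its heaviest child. -/
theorem RCGCBalancing.isRGCB (h : Admissible α β v y b) (ht : IsGCB α β t)
    (h31 : 31 ≤ weight t) (hr : RCGCBalancing α v β y t t') :
    IsRGCB α β t' ∧ maxChild t' ≤ maxChild t := by
  have hα := h.α_ge
  have hα' := h.α_le
  have hθ := h.le_threshold h.b_le_β (show 1 ≤ weight t by linarith)
  have step {s s' : BinaryTree K} (hs : Both (IsNearGCB α β (3 / 4)) s)
      (hss : OnSubtrees (CGCBalancing v v y y) s s') := hss.outcome (Q := IsGCB α β)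
    (fun _ _ hs hs' ↦ hs'.isGCB h hs) hs
  cases hr with
  | changedC t₁ t₂ t₃ h₁ ne h₂ h₃ h₄ =>
    obtain ⟨a1, a2, a3, a4⟩ := h₁.outcome_large h ht h31 ne
    have a5 := h₁.weight_eq
    obtain ⟨b1, b2, b3, b4⟩ := step a1 h₂
    have hθy := h.le_threshold h.b_le_y (show 1 ≤ weight t by linarith)
    -- After a rotation by the `C`-step the grandchildren are already below the threshold for `y`,
    -- so the middle `GC`-step at the root does nothing.
    obtain rfl : t₃ = t₂ := h₃.eq_of_maxGrandchild_le (by rw [b1, a5]; linarith)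
    obtain ⟨c1, c2, c3, c4⟩ := step (b4.mono fun s hs ↦ (hs.isNearGCB h).mono hα') h₄
    exact ⟨isRGCB_of_bounds h c4 (by rw [c1, b1, a5]; linarith) (by rw [c1, b1, a5]; linarith),
      by linarith⟩
  | changedGC t₃ h₁ h₂ ne h₃ =>
    have hc := h₁.maxChild_le
    rw [R_of_half_le (by linarith)] at hc
    obtain ⟨a1, a2, a3⟩ := h₂.outcome_large h ht h31 (by linarith) ne
    obtain ⟨b1, b2, b3, b4⟩ := step a1 h₃
    have a5 := h₂.weight_eq
    exact ⟨isRGCB_of_bounds h b4 (by rw [b1, a5]; linarith) (by rw [b1, a5]; linarith),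
      by linarith⟩
  | unchanged h₁ h₂ same =>
    have hc := h₁.maxChild_le
    rw [R_of_half_le (by linarith)] at hc
    subst same
    exact ⟨isRGCB_of_bounds h ht.both (by linarith) h₂.maxGrandchild_le, le_rfl⟩

end Rebalancing

/-! ### The explicit parameters satisfy the numerical conditions -/

section Parameters

variable {α β : ℝ}

theorem B_sq_add (hα : 0 ≤ α) : B α + B α ^ 2 = α := by
  have := Real.sq_sqrt (show 0 ≤ 1 + 4 * α by linarith)
  rw [B]
  linarith

theorem B_ge (hα : 707 / 1000 ≤ α) : 239 / 500 ≤ B α := by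
  have : 489 / 250 ≤ √(1 + 4 * α) := Real.le_sqrt_of_sq_le (by linarith)
  rw [B]
  linarith

theorem B_le (hα : α ≤ 3 / 4) : B α ≤ 1 / 2 := by
  have : √(1 + 4 * α) ≤ 2 := Real.sqrt_le_iff.2 ⟨by norm_num, by linarith⟩
  rw [B]
  linarith

theorem le_alphaHat {c : ℝ} (h1 : 1 / 2 < α)
    (hc : 0 ≤ 1 - 2 * α + 6 * α ^ 2 - c * (5 * (2 * α - 1)))
    (hc' : (1 - α) * (5 - α) ≤ (1 - 2 * α + 6 * α ^ 2 - c * (5 * (2 * α - 1))) ^ 2) :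
    c ≤ alphaHat α := by
  have := Real.sqrt_le_iff.2 ⟨hc, hc'⟩
  rw [alphaHat, le_div_iff₀ (by linarith)]
  linarith

/-- After clearing the square root, the difference of the two sides carries the factor `2 * α ^ 2 -
1`: the bound `1/√2` on `α` is sharp here, with `alphaHat α = α` at that point. -/
theorem alphaHat_le (h1 : 1 / 2 < α) (h2 : α ≤ 3 / 4) (hsq : 1 / 2 ≤ α ^ 2) :
    alphaHat α ≤ α := by
  have : (1 - α) * (1 + 4 * α) ≤ √((1 - α) * (5 - α)) := by
    refine Real.le_sqrt_of_sq_le ?_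
    have h3 : 0 ≤ (1 - α) * ((2 * α - 1) * (2 * α ^ 2 - 1)) :=
      mul_nonneg (by linarith) (mul_nonneg (by linarith) (by linarith))
    linarith
  rw [alphaHat, div_le_iff₀ (by linarith)]
  linarith

/-- Substituting this value of `c` in `le_alphaHat` leaves a polynomial that is again divisible by
`2 * α ^ 2 - 1`, so equality holds at `1/√2`. -/
theorem alphaHat_ge (h1 : 7 / 10 ≤ α) (h2 : α ≤ 3 / 4) (hsq : 1 / 2 ≤ α ^ 2) :
    (1 + α) / (1 + 2 * α) ≤ alphaHat α := by
  have hpos : 0 < 1 + 2 * α := by linarith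
  have e : 1 - 2 * α + 6 * α ^ 2 - (1 + α) / (1 + 2 * α) * (5 * (2 * α - 1)) =
      (12 * α ^ 3 - 8 * α ^ 2 - 5 * α + 6) / (1 + 2 * α) := by
    field_simp
    ring
  refine le_alphaHat (by linarith) ?_ ?_
  · rw [e]
    refine div_nonneg ?_ hpos.le
    nlinarith
  · rw [e, div_pow, le_div_iff₀ (by positivity)]
    have h3 : 0 ≤ 36 * α ^ 3 - 30 * α ^ 2 - 12 * α + 31 := by nlinarith
    have h4 : 0 ≤ (2 * α ^ 2 - 1) * ((2 * α - 1) * (36 * α ^ 3 - 30 * α ^ 2 - 12 * α + 31)) :=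
      mul_nonneg (by linarith) (mul_nonneg (by linarith) h3)
    linarith

theorem alphaHat_ge' (h1 : 707 / 1000 ≤ α) (h2 : α ≤ 3 / 4) :
    18 / 25 * α + 123 / 625 ≤ alphaHat α := by
  refine le_alphaHat (by linarith) ?_ ?_
  · nlinarith
  · have h3 : 0 ≤ 1124 / 1000 - 2117 / 1000 * (α - 707 / 1000) := by linarith
    -- The right side is a concave quadratic in `α`, and the left side lies just below its chord
    -- over `[0.707, 0.75]`.
    have h4 : 1124 / 1000 - 2117 / 1000 * (α - 707 / 1000) ≤
        1 - 2 * α + 6 * α ^ 2 - (18 / 25 * α + 123 / 625) * (5 * (2 * α - 1)) := by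
      nlinarith [mul_nonneg (sub_nonneg.2 h1) (sub_nonneg.2 h2)]
    refine le_trans ?_ (pow_le_pow_left₀ h3 h4 2)
    nlinarith [sq_nonneg (α - 729 / 1000), sq_nonneg (α - 73 / 100)]

/-- `betaHat α β` is `α` times the smaller root of a quadratic polynomial. -/
theorem le_betaHat {t : ℝ} (h1 : 7 / 10 ≤ α) (h2 : α ≤ 3 / 4) (hβ : 0 ≤ β) (hβ' : β ≤ α ^ 2)
    (ht : t ≤ α) (hq : 0 ≤ (1 - α ^ 2 + β) * t ^ 2 - (1 + α) * t + α) :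
    t * α ≤ betaHat α β := by
  have ha : 0 < 1 - α ^ 2 + β := by nlinarith
  have hs : √((1 - α) ^ 2 + 4 * α * (α ^ 2 - β)) ≤ 1 + α - 2 * (1 - α ^ 2 + β) * t := by
    rw [Real.sqrt_le_iff]
    constructor
    -- This places `t` to the left of the vertex, since `α ≤ (1 + α) / 2`; there a nonnegative value
    -- of the quadratic means being left of the smaller root.
    · have : (1 - α ^ 2 + β) * t ≤ 1 * α := by
        by_cases h0 : 0 ≤ t
        · gcongr
          linarith
        · nlinarith
      linarith
    · have := mul_nonneg ha.le hq
      linarith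
  rw [betaHat]
  gcongr
  rw [le_div_iff₀ (by linarith)]
  linarith

/-- Where the quadratic with positive leading coefficient is nonpositive, its smaller root lies to
the left. -/
theorem betaHat_le {t : ℝ} (h1 : 7 / 10 ≤ α) (h2 : α ≤ 3 / 4) (hβ : 0 ≤ β)
    (hq : (1 - α ^ 2 + β) * t ^ 2 - (1 + α) * t + α ≤ 0) :
    betaHat α β ≤ t * α := by
  have ha : 0 < 1 - α ^ 2 + β := by nlinarith
  have hs : 1 + α - 2 * (1 - α ^ 2 + β) * t ≤ √((1 - α) ^ 2 + 4 * α * (α ^ 2 - β)) := by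
    refine Real.le_sqrt_of_sq_le ?_
    have := mul_nonneg ha.le (sub_nonneg.2 hq)
    linarith
  rw [betaHat]
  gcongr
  rw [div_le_iff₀ (by linarith)]
  linarith

theorem admissible (hα : 1 / √2 ≤ α) (hα' : α < 3 / 4) (hβ : B α ≤ β) (hβ' : β ≤ α ^ 2) :
    Admissible α β (alphaHat α) (betaHat α β) (B α) := by
  have hsq : 1 / 2 ≤ α ^ 2 := by
    have : (1 / √2) ^ 2 ≤ α ^ 2 := by gcongr
    rwa [div_pow, Real.sq_sqrt (by norm_num), one_pow] at this
  have hα0 : 0 ≤ α := le_trans (by positivity) hα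
  have h1 : 707 / 1000 ≤ α := by
    by_contra! hc
    nlinarith
  have hb := B_ge h1
  have hb' := B_le hα'.le
  have hB := B_sq_add hα0
  have hβ9 : β ≤ 9 / 16 := by nlinarith
  generalize B α = b at *
  have h2α : 0 < 1 + 2 * α := by linarith
  refine ⟨hb, hb', hB.symm, hsq, alphaHat_le (by linarith) hα'.le hsq, ?_,
    alphaHat_ge' h1 hα'.le, ?_, ?_, hβ', ?_⟩
  · have := alphaHat_ge (by linarith) hα'.le hsq
    rwa [div_le_iff₀ h2α] at this
  · have h3 : b / α * α = b := div_mul_cancel₀ _ (by linarith)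
    rw [← h3]
    refine le_betaHat (by linarith) hα'.le (by linarith) hβ' ?_ ?_
    · rw [div_le_iff₀ (by linarith)]
      linarith
    · have : (1 - α ^ 2 + β) * (b / α) ^ 2 - (1 + α) * (b / α) + α =
        b ^ 2 * (β - b) / α ^ 2 := by
        have : α ≠ 0 := by linarith
        field_simp
        linear_combination (b - α ^ 2) * hB
      rw [this]
      have : 0 ≤ β - b := by linarith
      positivity
  · have h3 : β / α * α = β := div_mul_cancel₀ _ (by linarith)
    rw [← h3]
    nth_rewrite 1 [h3]
    refine betaHat_le (by linarith) hα'.le (by linarith) ?_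
    have : (1 - α ^ 2 + β) * (β / α) ^ 2 - (1 + α) * (β / α) + α =
        (α ^ 2 - β) * (α - β - β ^ 2) / α ^ 2 := by
      field_simp
      ring
    rw [this]
    -- The remaining factor `α - β - β ^ 2` is nonpositive exactly because `β ≥ b` and `b + b ^ 2 =
    -- α`.
    refine div_nonpos_of_nonpos_of_nonneg (mul_nonpos_of_nonneg_of_nonpos (by linarith) ?_)
      (by positivity)
    nlinarith
  · have h3 : 1 / (2 - β) * α ≤ betaHat α β := by
      refine le_betaHat (by linarith) hα'.le (by linarith) hβ' ?_ ?_
      · rw [div_le_iff₀ (by linarith)]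
        nlinarith
      · have : (1 - α ^ 2 + β) * (1 / (2 - β)) ^ 2 - (1 + α) * (1 / (2 - β)) + α =
          (α * β ^ 2 + (2 - 3 * α) * β - (1 - α) ^ 2) / (2 - β) ^ 2 := by
          have : 2 - β ≠ 0 := by linarith
          field_simp
          ring
        rw [this]
        refine div_nonneg ?_ (by positivity)
        -- The numerator is the sum of its value at `β = b`, which is `h3`, and its increment from
        -- `b` to `β`, which is `h4`.
        have h3 : 0 ≤ (1 - 2 * b) * (2 * α - 1) := mul_nonneg (by linarith) (by linarith)
        have h4 : 0 ≤ (β - b) * (α * (β + b - 3) + 2) := mul_nonneg (by linarith) (by nlinarith)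
        rw [← hB] at h3 h4 ⊢
        linarith
    rw [div_mul_eq_mul_div, one_mul, div_le_iff₀ (by linarith)] at h3
    linarith

end Parameters

/-! ### The rebalancing steps can always be carried out -/

section Existence

variable {K : Type*} {t : BinaryTree K}

theorem eq_nil_of_weight_le_one (h : weight t ≤ 1) : t = nil := by
  cases t with
  | nil => rfl
  | node x l r =>
    have := one_le_weight l
    have := one_le_weight r
    simp only [weight_node] at h
    linarith

theorem exists_node_of_lt_weight {c : ℝ} (hc : 1 ≤ c) (h : c < weight t) :
    ∃ x l r, t = node x l r := by
  cases t with
  | nil => simp only [weight_nil] at h; linarith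
  | node x l r => exact ⟨x, l, r, rfl⟩

theorem exists_simpleRot (h : 2 / 5 * weight t < w₁₁ t) : ∃ t', SimpleRot t t' := by
  match t with
  | nil => simp only [weight_nil, w₁₁] at h; linarith
  | node x nil r =>
    have := one_le_weight r
    simp only [weight_node, weight_nil, w₁₁, w₁] at h; linarith
  | node x (node x₁ A B) C => exact ⟨_, .mk ..⟩

theorem exists_simpleRotMirror (h : 2 / 5 * weight t < w₂₂ t) : ∃ t', SimpleRotMirror t t' := by
  match t with
  | nil => simp only [weight_nil, w₂₂] at h; linarith
  | node x l nil =>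
    have := one_le_weight l
    simp only [weight_node, weight_nil, w₂₂, w₂] at h; linarith
  | node x A (node x₂ B C) => exact ⟨_, .mk ..⟩

/-- A missing node to be lifted would make the grandchild weigh at most one third of the tree: `1`
out of at least `3`, `1/2` out of at least `2`, or `1/4` out of `1`. The other rotations are treated
with the same constant `2/5`. -/
theorem exists_doubleRot (h : 2 / 5 * weight t < w₁₂ t) : ∃ t', DoubleRot t t' := by
  match t with
  | nil => simp only [weight_nil, w₁₂] at h; linarith
  | node x nil r =>
    have := one_le_weight r
    simp only [weight_node, weight_nil, w₁₂, w₂] at h; linarith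
  | node x (node x₁ A nil) C =>
    have := one_le_weight A
    have := one_le_weight C
    simp only [weight_node, weight_nil, w₁₂, w₂] at h; linarith
  | node x (node x₁ A (node x₁₂ B C)) D => exact ⟨_, .mk ..⟩

theorem exists_doubleRotMirror (h : 2 / 5 * weight t < w₂₁ t) : ∃ t', DoubleRotMirror t t' := by
  match t with
  | nil => simp only [weight_nil, w₂₁] at h; linarith
  | node x l nil =>
    have := one_le_weight l
    simp only [weight_node, weight_nil, w₂₁, w₁] at h; linarith
  | node x A (node x₂ nil C) =>
    have := one_le_weight A
    have := one_le_weight C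
    simp only [weight_node, weight_nil, w₂₁, w₁] at h; linarith
  | node x A (node x₂ (node x₂₁ B C) D) => exact ⟨_, .mk ..⟩

theorem exists_gcBalancing {y z : ℝ} (h : 2 / 5 * weight t ≤ y * weight t + z) :
    ∃ t', GCBalancing y z t t' := by
  by_cases h₁ : w₁₁ t > y * weight t + z
  · obtain ⟨t', ht'⟩ := exists_simpleRot (h.trans_lt h₁)
    exact ⟨t', .case1 h₁ ht'⟩
  by_cases h₂ : w₂₂ t > y * weight t + z
  · obtain ⟨t', ht'⟩ := exists_simpleRotMirror (h.trans_lt h₂)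
    exact ⟨t', .case2 h₂ ht'⟩
  by_cases h₃ : w₁₂ t > y * weight t + z
  · obtain ⟨t', ht'⟩ := exists_doubleRot (h.trans_lt h₃)
    exact ⟨t', .case3 h₃ ht'⟩
  by_cases h₄ : w₂₁ t > y * weight t + z
  · obtain ⟨t', ht'⟩ := exists_doubleRotMirror (h.trans_lt h₄)
    exact ⟨t', .case4 h₄ ht'⟩
  rw [gt_iff_lt, not_lt] at *
  exact ⟨t, .case5 (max_le (max_le h₁ h₃) (max_le h₄ h₂)) rfl⟩

theorem exists_cBalancing {u v w x : ℝ} (h : 2 / 3 * weight t ≤ u * weight t + w)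
    (h' : (1 - v) * weight t - x ≤ 1 / 3 * weight t) : ∃ t', CBalancing u v w x t t' := by
  by_cases h₁ : w₁ t > u * weight t + w
  · have hw := h.trans_lt h₁
    match t with
    | nil => simp only [weight_nil, w₁] at hw; linarith
    | node x nil r =>
      have := one_le_weight r
      simp only [weight_node, weight_nil, w₁] at hw; linarith
    | node n (node n₁ A B) C =>
      by_cases h₂ : w₁₁ (node n (node n₁ A B) C) ≥ (1 - v) * weight (node n (node n₁ A B) C) - x
      · exact ⟨_, .case1 h₁ h₂ (.mk ..)⟩
      · rw [ge_iff_le, not_le] at h₂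
        cases B with
        -- With an empty `B`, the triggers say `weight A + 1 > 2 * weight C` and `2 * weight A < 1 +
        -- weight C`, forcing `weight C < 1`.
        | nil =>
          have h₃ := h₂.trans_le h'
          have := one_le_weight A
          have := one_le_weight C
          simp only [weight_node, weight_nil, w₁, w₁₁] at hw h₃
          linarith
        | node _ _ _ => exact ⟨_, .case3 h₁ h₂ (.mk ..)⟩
  by_cases h₂ : w₂ t > u * weight t + w
  · have hw := h.trans_lt h₂
    match t with
    | nil => simp only [weight_nil, w₂] at hw; linarith
    | node x l nil =>
      have := one_le_weight l
      simp only [weight_node, weight_nil, w₂] at hw; linarith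
    | node n A (node n₂ B C) =>
      by_cases h₃ : w₂₂ (node n A (node n₂ B C)) ≥ (1 - v) * weight (node n A (node n₂ B C)) - x
      · exact ⟨_, .case2 h₂ h₃ (.mk ..)⟩
      · rw [ge_iff_le, not_le] at h₃
        cases B with
        | nil =>
          have h₄ := h₃.trans_le h'
          have := one_le_weight A
          have := one_le_weight C
          simp only [weight_node, weight_nil, w₂, w₂₂] at hw h₄
          linarith
        | node _ _ _ => exact ⟨_, .case4 h₂ h₃ (.mk ..)⟩
  rw [gt_iff_lt, not_lt] at *
  exact ⟨t, .case5 (max_le h₁ h₂) rfl⟩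

theorem exists_onSubtrees {S : BinaryTree K → BinaryTree K → Prop} (hS : ∀ s, ∃ s', S s s')
    (ht : t ≠ nil) : ∃ t', OnSubtrees S t t' := by
  cases t with
  | nil => exact absurd rfl ht
  | node x l r =>
    obtain ⟨l', hl⟩ := hS l
    obtain ⟨r', hr⟩ := hS r
    exact ⟨_, .mk x l r l' r' hl hr⟩

theorem exists_cgcBalancing {v y : ℝ} (hv : 7 / 10 ≤ v) (hy : 2 / 5 ≤ y) (t : BinaryTree K) :
    ∃ t', CGCBalancing v v y y t t' := by
  have hgc (s : BinaryTree K) : ∃ s', GCBalancing y 0 s s' :=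
    exists_gcBalancing (by rw [add_zero]; have := weight_pos s; gcongr)
  have hW := weight_pos t
  obtain ⟨t₁, h₁⟩ := exists_cBalancing (t := t) (u := v) (v := v) (w := 0) (x := 0)
    (by rw [add_zero]; gcongr; linarith) (by rw [sub_zero]; gcongr; linarith)
  by_cases ne : t = t₁
  · subst ne
    obtain ⟨t', h₂⟩ := hgc t
    exact ⟨t', .unchanged h₁ h₂⟩
  · have : t₁ ≠ nil := by
      rintro rfl
      have := h₁.weight_eq
      exact ne (eq_nil_of_weight_le_one (by rw [← this, weight_nil]))
    obtain ⟨t₂, h₂⟩ := exists_onSubtrees hgc this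
    obtain ⟨t', h₃⟩ := hgc t₂
    exact ⟨t', .changed t₁ t₂ h₁ ne h₂ h₃⟩

theorem exists_rcgcBalancing {α β v y b : ℝ} (h : Admissible α β v y b) (h31 : 31 ≤ weight t) :
    ∃ t', RCGCBalancing α v β y t t' := by
  have hα := h.α_ge; have hv := h.v_ge_seven; have hb := h.b_ge; have hby := h.b_le_y
  have hcgc := exists_cgcBalancing (K := K) hv (show 2 / 5 ≤ y by linarith)
  have ne_nil {s : BinaryTree K} (hs : weight s = weight t) : s ≠ nil := by
    rintro rfl
    rw [weight_nil] at hs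
    linarith
  have hgc {s : BinaryTree K} {r : ℝ} (hs : weight s = weight t) (hr : b ≤ r) :
      ∃ s', GCBalancing r (R r) s s' := by
    have h1 := h.le_threshold hr (show 1 ≤ weight s by linarith)
    have h2 := h.threshold_ge (show 31 ≤ weight s by linarith)
    exact exists_gcBalancing (by linarith)
  obtain ⟨t₁, h₁⟩ : ∃ t₁, CBalancing α v (R α) (R v) t t₁ := by
    rw [R_of_half_le (by linarith), R_of_half_le (by linarith)]
    have h1 : 707 / 1000 * (weight t - 1) ≤ α * (weight t - 1) := by gcongr; linarith
    have h2 : 7 / 10 * (weight t - 1) ≤ v * (weight t - 1) := by gcongr; linarith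
    exact exists_cBalancing (by linarith) (by linarith)
  by_cases ne : t = t₁
  · subst ne
    obtain ⟨t₃, h₂⟩ := hgc rfl h.b_le_β
    by_cases ne : t = t₃
    · subst ne
      exact ⟨t, .unchanged h₁ h₂ rfl⟩
    · obtain ⟨t', h₃⟩ := exists_onSubtrees hcgc (ne_nil h₂.weight_eq)
      exact ⟨t', .changedGC t₃ h₁ h₂ ne h₃⟩
  · have e₁ := h₁.weight_eq
    obtain ⟨t₂, h₂⟩ := exists_onSubtrees hcgc (ne_nil e₁)
    have e₂ := (h₂.weight_eq fun _ _ ↦ CGCBalancing.weight_eq).trans e₁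
    obtain ⟨t₃, h₃⟩ := hgc e₂ hby
    obtain ⟨t', h₄⟩ := exists_onSubtrees hcgc (ne_nil (h₃.weight_eq.trans e₂))
    exact ⟨t', .changedC t₁ t₂ t₃ h₁ ne h₂ h₃ h₄⟩

end Existence

/-! ### Keys and the search-tree order -/

section SearchTrees

theorem finite_keys {K : Type*} (t : BinaryTree K) : (keys t).Finite := by
  induction t with
  | nil => exact Set.finite_empty
  | node a l r hl hr => exact (hl.union hr).insert a

variable {K : Type*} [LinearOrder K] {t t' : BinaryTree K}

/-- The trees `t` and `t'` have the same keys, and `t'` is a search tree if `t` is one. -/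
def PreservesKeys (t t' : BinaryTree K) : Prop := keys t' = keys t ∧ (IsBST t → IsBST t')

theorem PreservesKeys.refl (t : BinaryTree K) : PreservesKeys t t := ⟨rfl, id⟩

theorem PreservesKeys.trans {s : BinaryTree K} (h : PreservesKeys t t') (h' : PreservesKeys t' s) :
    PreservesKeys t s :=
  ⟨h'.1.trans h.1, h'.2 ∘ h.2⟩

theorem SimpleRot.preservesKeys (h : SimpleRot t t') : PreservesKeys t t' := by
  cases h
  constructor
  · ext k; simp only [keys, Set.mem_insert_iff, Set.mem_union]; tauto
  · intro h
    simp only [IsBST, keys, Set.mem_insert_iff, Set.mem_union, or_imp, forall_and,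
      forall_eq] at h ⊢
    obtain ⟨⟨h₁, h₂, h₃⟩, h₄, ⟨h₅, h₆, h₇, h₈⟩, h₉⟩ := h
    exact ⟨h₅, ⟨h₁, h₆, fun k hk ↦ h₁.trans (h₄ k hk)⟩, h₇, h₃, h₄, h₈, h₉⟩

theorem SimpleRotMirror.preservesKeys (h : SimpleRotMirror t t') : PreservesKeys t t' := by
  cases h
  constructor
  · ext k; simp only [keys, Set.mem_insert_iff, Set.mem_union]; tauto
  · intro h
    simp only [IsBST, keys, Set.mem_insert_iff, Set.mem_union, or_imp, forall_and,
      forall_eq] at h ⊢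
    obtain ⟨h₁, ⟨h₂, h₃, h₄⟩, h₅, h₆, h₇, h₈, h₉⟩ := h
    exact ⟨⟨h₂, fun k hk ↦ (h₁ k hk).trans h₂, h₆⟩, h₇, ⟨h₁, h₃, h₅, h₈⟩, h₉⟩

theorem DoubleRot.preservesKeys (h : DoubleRot t t') : PreservesKeys t t' := by
  cases h
  constructor
  · ext k; simp only [keys, Set.mem_insert_iff, Set.mem_union]; tauto
  · intro h
    simp only [IsBST, keys, Set.mem_insert_iff, Set.mem_union, or_imp, forall_and,
      forall_eq] at h ⊢
    obtain ⟨⟨h₁, h₂, h₃, h₄, h₅⟩, h₆, ⟨h₇, ⟨h₈, h₉, h₁₀⟩, h₁₁, h₁₂, h₁₃, h₁₄, h₁₅⟩, h₁₆⟩ := h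
    exact ⟨⟨h₈, fun k hk ↦ (h₇ k hk).trans h₈, h₁₂⟩, ⟨h₃, h₁₃, fun k hk ↦ h₃.trans (h₆ k hk)⟩,
      ⟨h₇, h₉, h₁₁, h₁₄⟩, h₅, h₆, h₁₅, h₁₆⟩

theorem DoubleRotMirror.preservesKeys (h : DoubleRotMirror t t') : PreservesKeys t t' := by
  cases h
  constructor
  · ext k; simp only [keys, Set.mem_insert_iff, Set.mem_union]; tauto
  · intro h
    simp only [IsBST, keys, Set.mem_insert_iff, Set.mem_union, or_imp, forall_and,
      forall_eq] at h ⊢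
    obtain ⟨h₁, ⟨h₂, ⟨h₃, h₄, h₅⟩, h₆⟩, h₇, ⟨h₈, h₉, h₁₀⟩, h₁₁, ⟨h₁₂, h₁₃, h₁₄, h₁₅⟩, h₁₆⟩ := h
    exact ⟨⟨h₃, fun k hk ↦ (h₁ k hk).trans h₃, h₁₂⟩, ⟨h₈, h₁₃, fun k hk ↦ h₈.trans (h₁₁ k hk)⟩,
      ⟨h₁, h₄, h₇, h₁₄⟩, h₁₀, h₁₁, h₁₅, h₁₆⟩

theorem CBalancing.preservesKeys {u v w x : ℝ} (h : CBalancing u v w x t t') :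
    PreservesKeys t t' := by
  cases h with
  | case1 _ _ h => exact h.preservesKeys
  | case2 _ _ h => exact h.preservesKeys
  | case3 _ _ h => exact h.preservesKeys
  | case4 _ _ h => exact h.preservesKeys
  | case5 _ h => exact h ▸ .refl _

theorem GCBalancing.preservesKeys {y z : ℝ} (h : GCBalancing y z t t') : PreservesKeys t t' := by
  cases h with
  | case1 _ h => exact h.preservesKeys
  | case2 _ h => exact h.preservesKeys
  | case3 _ h => exact h.preservesKeys
  | case4 _ h => exact h.preservesKeys
  | case5 _ h => exact h ▸ .refl _

theorem OnSubtrees.preservesKeys {S : BinaryTree K → BinaryTree K → Prop}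
    (hS : ∀ s s', S s s' → PreservesKeys s s') (h : OnSubtrees S t t') : PreservesKeys t t' := by
  cases h with
  | mk a l r l' r' hl hr =>
    obtain ⟨l1, l2⟩ := hS _ _ hl
    obtain ⟨r1, r2⟩ := hS _ _ hr
    simp only [PreservesKeys, keys, IsBST, l1, r1]
    tauto

theorem CGCBalancing.preservesKeys {u v y z : ℝ} (h : CGCBalancing u v y z t t') :
    PreservesKeys t t' := by
  cases h with
  | changed t₁ t₂ h₁ _ h₂ h₃ =>
    exact (h₁.preservesKeys.trans (h₂.preservesKeys fun _ _ ↦ GCBalancing.preservesKeys)).trans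
      h₃.preservesKeys
  | unchanged _ h₂ => exact h₂.preservesKeys

theorem RCGCBalancing.preservesKeys {u v y z : ℝ} (h : RCGCBalancing u v y z t t') :
    PreservesKeys t t' := by
  cases h with
  | changedC t₁ t₂ t₃ h₁ _ h₂ h₃ h₄ =>
    exact ((h₁.preservesKeys.trans (h₂.preservesKeys fun _ _ ↦ CGCBalancing.preservesKeys)).trans
      h₃.preservesKeys).trans (h₄.preservesKeys fun _ _ ↦ CGCBalancing.preservesKeys)
  | changedGC t₃ _ h₂ _ h₃ =>
    exact h₂.preservesKeys.trans (h₃.preservesKeys fun _ _ ↦ CGCBalancing.preservesKeys)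
  | unchanged _ _ same => exact same ▸ .refl _

/-- Small trees are rebuilt arbitrarily from their key sets, so their change of weight has to be
read off from the keys. -/
theorem IsBST.weight_eq (h : IsBST t) : weight t = (keys t).ncard + 1 := by
  induction t with
  | nil => simp [keys]
  | node a l r hl hr =>
    obtain ⟨h1, h2, h3, h4⟩ := h
    have ha : a ∉ keys l ∪ keys r := by
      rintro (h | h)
      · exact lt_irrefl _ (h1 _ h)
      · exact lt_irrefl _ (h2 _ h)
    have hd : Disjoint (keys l) (keys r) :=
      Set.disjoint_left.2 fun k hk hk' ↦ lt_asymm (h1 _ hk) (h2 _ hk')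
    rw [weight_node, hl h3, hr h4, keys,
      Set.ncard_insert_of_notMem ha ((finite_keys l).union (finite_keys r)),
      Set.ncard_union_eq hd (finite_keys l) (finite_keys r)]
    push_cast
    ring

end SearchTrees

/-! ### Perfectly balanced trees -/

section PerfectTrees

variable {K : Type*}

/-- The worst case is a pair of siblings of weights `1` and `2`. Two levels then give `4/9`, which
is below `b`. -/
theorem PerfectlyBalanced.maxChild_le {t : BinaryTree K} (ht : PerfectlyBalanced t) :
    maxChild t ≤ 2 / 3 * weight t := by
  cases t with
  | nil => simp only [maxChild, w₁, w₂, max_self, weight_nil]; norm_num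
  | node x l r =>
    have h := abs_le.1 ht.1
    have := one_le_weight l
    have := one_le_weight r
    simp only [maxChild_node, weight_node]
    exact max_le (by linarith) (by linarith)

theorem PerfectlyBalanced.isGCB {α β : ℝ} (hα : 2 / 3 ≤ α) (hβ : 4 / 9 ≤ β) {t : BinaryTree K}
    (ht : PerfectlyBalanced t) : IsGCB α β t := by
  induction t with
  | nil => trivial
  | node x l r hl hr =>
    refine ⟨(isBalanced_iff _).2 ⟨?_, ?_⟩, hl ht.2.1, hr ht.2.2⟩
    · refine ht.maxChild_le.trans ?_
      have := weight_pos (node x l r)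
      gcongr
    · have h1 := ht.maxChild_le
      have h2 := weight_pos (node x l r)
      have h3 : 4 / 9 * weight (node x l r) ≤ β * weight (node x l r) := by gcongr
      have h4 := ht.2.1.maxChild_le
      have h5 := ht.2.2.maxChild_le
      simp only [maxChild_node, max_le_iff] at h1
      rw [maxGrandchild_node]
      exact max_le (by linarith) (by linarith)

theorem weight_le_two_mul_maxChild (t : BinaryTree K) : weight t ≤ 2 * maxChild t := by
  have h1 := le_max_left (w₁ t) (w₂ t)
  have h2 := le_max_right (w₁ t) (w₂ t)
  have h3 := w₁_add_w₂ t
  rw [maxChild]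
  linarith

/-- The tree `t'` is an update of `t`: their weights differ by at most `1`, and the weight of the
heaviest child grows at most as much as the weight of the tree. -/
def IsUpdate (t t' : BinaryTree K) : Prop :=
  |weight t' - weight t| ≤ 1 ∧ maxChild t' ≤ maxChild t + max 0 (weight t' - weight t)

theorem PerfectlyBalanced.isUpdate {t t' : BinaryTree K} (ht' : PerfectlyBalanced t')
    (h : |weight t' - weight t| ≤ 1) : IsUpdate t t' := by
  refine ⟨h, ?_⟩
  cases t' with
  | nil =>
    have h1 := weight_le_two_mul_maxChild t
    have h2 := one_le_weight t
    have h3 := le_max_left 0 (weight (nil : BinaryTree K) - weight t)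
    simp only [maxChild, w₁, w₂, max_self] at h1 h2 h3 ⊢
    linarith
  | node x l r =>
    cases t with
    | nil =>
      have h1 := le_max_right 0 (weight (node x l r) - weight (nil : BinaryTree K))
      have h2 := one_le_weight l
      have h3 := one_le_weight r
      refine le_trans ?_ (add_le_add_right h1 _)
      simp only [weight_node, weight_nil, maxChild, w₁, w₂, max_self]
      exact max_le (by linarith) (by linarith)
    | node x' l' r' =>
      have hb := ht'.1
      simp only [weight_node, maxChild_node] at h ⊢
      unfold weight at *
      have cast (m n : ℕ) : |(m : ℝ) - n| ≤ 1 → m ≤ n + 1 ∧ n ≤ m + 1 := by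
        rw [abs_sub_le_iff, sub_le_iff_le_add', sub_le_iff_le_add']
        norm_cast
        omega
      have h := cast (l.numLeaves + r.numLeaves) (l'.numLeaves + r'.numLeaves)
        (by push_cast; exact h)
      have hb := cast _ _ hb
      -- The heaviest child is at least half the weight, rounded up, with equality for perfectly
      -- balanced trees. So it cannot grow unless the weight does, and then it grows by at most `1`.
      rcases le_or_gt (l.numLeaves + r.numLeaves) (l'.numLeaves + r'.numLeaves) with hle | hlt
      · have : max l.numLeaves r.numLeaves ≤ max l'.numLeaves r'.numLeaves := by omega
        have h1 : ((max l.numLeaves r.numLeaves : ℕ) : ℝ) ≤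
          (max l'.numLeaves r'.numLeaves : ℕ) := by exact_mod_cast this
        push_cast at h1 ⊢
        exact h1.trans (le_add_of_nonneg_right (le_max_left _ _))
      · have : max l.numLeaves r.numLeaves ≤ max l'.numLeaves r'.numLeaves + 1 := by omega
        have h1 : ((max l.numLeaves r.numLeaves : ℕ) : ℝ) ≤
          (max l'.numLeaves r'.numLeaves : ℕ) + 1 := by exact_mod_cast this
        have h2 : (l'.numLeaves + r'.numLeaves : ℝ) + 1 ≤ l.numLeaves + r.numLeaves := by
          exact_mod_cast hlt
        push_cast at h1 ⊢
        refine h1.trans (add_le_add_right (le_max_of_le_right ?_) _)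
        linarith

variable [LinearOrder K]

/-- The median becomes the root, and the two halves of the sorted list are treated recursively. -/
theorem exists_perfectlyBalanced_of_list (l : List K) (hl : l.Pairwise (· < ·)) :
    ∃ t : BinaryTree K, IsBST t ∧ keys t = {k | k ∈ l} ∧ PerfectlyBalanced t ∧
      t.numNodes = l.length := by
  induction hn : l.length using Nat.strong_induction_on generalizing l with
  | _ n ih =>
    rcases Nat.eq_zero_or_pos n with h0 | h0
    · obtain rfl := List.length_eq_zero_iff.1 (hn.trans h0)
      exact ⟨nil, trivial, by simp [keys], trivial, by simp [h0]⟩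
    · have hlt : n / 2 < l.length := by omega
      have hsplit : l = l.take (n / 2) ++ l[n / 2] :: l.drop (n / 2 + 1) := by
        rw [← List.drop_eq_getElem_cons hlt, List.take_append_drop]
      rw [hsplit, List.pairwise_append, List.pairwise_cons] at hl
      obtain ⟨h1, ⟨h2, h3⟩, h4⟩ := hl
      obtain ⟨t₁, a1, a2, a3, a4⟩ := ih _ (by rw [List.length_take]; omega) _ h1 rfl
      obtain ⟨t₂, b1, b2, b3, b4⟩ := ih _ (by rw [List.length_drop]; omega) _ h3 rfl
      rw [List.length_take] at a4
      rw [List.length_drop] at b4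
      refine ⟨node l[n / 2] t₁ t₂, ⟨?_, ?_, a1, b1⟩, ?_, ⟨?_, a3, b3⟩, ?_⟩
      · rw [a2]
        exact fun k hk ↦ h4 k hk _ List.mem_cons_self
      · rw [b2]
        exact fun k hk ↦ h2 k hk
      · ext k
        conv_rhs => rw [hsplit]
        simp only [keys, a2, b2, Set.mem_insert_iff, Set.mem_union, Set.mem_ofPred_eq,
          List.mem_append, List.mem_cons]
        tauto
      · rw [weight_eq_numNodes, weight_eq_numNodes, a4, b4, abs_le]
        have e1 : min (n / 2) l.length ≤ l.length - (n / 2 + 1) + 1 := by omega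
        have e2 : l.length - (n / 2 + 1) ≤ min (n / 2) l.length + 1 := by omega
        have e3 : ((min (n / 2) l.length : ℕ) : ℝ) ≤ (l.length - (n / 2 + 1) : ℕ) + 1 := by
          exact_mod_cast e1
        have e4 : ((l.length - (n / 2 + 1) : ℕ) : ℝ) ≤ (min (n / 2) l.length : ℕ) + 1 := by
          exact_mod_cast e2
        constructor <;> linarith
      · rw [numNodes, a4, b4]
        omega

theorem exists_perfectlyBalanced {s : Set K} (hs : s.Finite) :
    ∃ t : BinaryTree K, IsBST t ∧ keys t = s ∧ PerfectlyBalanced t := by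
  obtain ⟨t, h1, h2, h3, -⟩ := exists_perfectlyBalanced_of_list hs.toFinset.sort
    hs.toFinset.sortedLT_sort.pairwise
  exact ⟨t, h1, by simp [h2], h3⟩

end PerfectTrees

/-! ### Robust roots tolerate updates of a sub-tree -/

section Updates

variable {K : Type*} {α β v y b : ℝ} {t t' : BinaryTree K}

/-- Updating the left sub-tree of a robust tree. -/
theorem IsRGCB.update_left (h : Admissible α β v y b) {a : K} {l r l' : BinaryTree K}
    (ht : IsRGCB α β (node a l r)) (hl : IsUpdate l l') (hl' : IsGCB α β l') :
    IsGCB α β (node a l' r) ∧ IsUpdate (node a l r) (node a l' r) := by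
  obtain ⟨⟨⟨c1, c2⟩, c3, c4⟩, -, hr⟩ := ht
  obtain ⟨d1, d2⟩ := hl
  rw [abs_le] at d1
  have hα := h.α_le
  have hβ := h.β_le'
  have hα' := h.α_ge
  have hβ' := h.b_le_β.trans' h.b_ge
  simp only [maxGrandchild_node, maxChild_node, weight_node] at c1 c2 c3 c4
  obtain ⟨δ, hδ⟩ : ∃ δ, δ = weight l' - weight l := ⟨_, rfl⟩
  rw [← hδ] at d1 d2
  have e : weight l' = weight l + δ := by linarith
  -- For `δ ≥ 0` this follows from the case `δ = 1` since `γ ≤ 1`; for `δ ≤ 0`, from the case `δ =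
  -- -1` since `γ ≥ 0`. It is applied to children with `γ = α` and to grandchildren with `γ = β`.
  have grow {γ M n : ℝ} (g0 : 0 ≤ γ) (g1 : γ ≤ 1) (h1 : M + 1 ≤ γ * (n + 1))
      (h2 : M ≤ γ * (n - 1)) : M + max 0 δ ≤ γ * (n + δ) := by
    rcases le_total 0 δ with h0 | h0
    · rw [max_eq_right h0]
      have : γ * (1 - δ) ≤ 1 * (1 - δ) := by gcongr; linarith
      linarith
    · rw [max_eq_left h0]
      have : γ * (n - 1) ≤ γ * (n + δ) := by gcongr; linarith
      linarith
  have f1 := grow (by linarith) (by linarith) c1 c2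
  have f2 := grow (by linarith) (by linarith) c3 c4
  have m0 := le_max_left 0 δ
  have m1 := le_max_right 0 δ
  have ml := le_max_left (weight l) (weight r)
  have mr := le_max_right (weight l) (weight r)
  have ml' := le_max_left (maxChild l) (maxChild r)
  have mr' := le_max_right (maxChild l) (maxChild r)
  refine ⟨⟨(isBalanced_iff _).2 ⟨?_, ?_⟩, hl', hr⟩, ?_, ?_⟩
  · simp only [maxChild_node, weight_node, e]
    exact max_le (by linarith) (by linarith)
  · simp only [maxGrandchild_node, weight_node, e]
    exact max_le (by linarith) (by linarith)
  · simp only [weight_node, e]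
    rw [abs_le]
    constructor <;> linarith
  · simp only [maxChild_node, weight_node, e]
    rw [show weight l + δ + weight r - (weight l + weight r) = δ by ring]
    exact max_le (by linarith) (by linarith)

theorem isRGCB_mirror : IsRGCB α β (mirror t) ↔ IsRGCB α β t := by
  cases t with
  | nil => rfl
  | node a l r =>
    have h1 := maxChild_mirror (node a l r)
    have h2 := maxGrandchild_mirror (node a l r)
    have h3 := weight_mirror (node a l r)
    simp only [mirror] at h1 h2 h3
    simp only [mirror, IsRGCB, RobustlyBalanced, h1, h2, h3, isGCB_mirror]
    tauto

/-- Updating the right sub-tree of a robust tree. -/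
theorem IsRGCB.update_right (h : Admissible α β v y b) {a : K} {l r r' : BinaryTree K}
    (ht : IsRGCB α β (node a l r)) (hr : IsUpdate r r') (hr' : IsGCB α β r') :
    IsGCB α β (node a l r') ∧ IsUpdate (node a l r) (node a l r') := by
  have := IsRGCB.update_left h (a := a) (l := mirror r) (r := mirror l) (l' := mirror r')
    (isRGCB_mirror.2 ht) (by simpa [IsUpdate] using hr) (by simpa using hr')
  rw [show node a (mirror r') (mirror l) = mirror (node a l r') from rfl,
    show node a (mirror r) (mirror l) = mirror (node a l r) from rfl] at this
  simpa [IsUpdate] using this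

theorem IsUpdate.of_le (hw : weight t' = weight t) (hm : maxChild t' ≤ maxChild t)
    {s : BinaryTree K} (h : IsUpdate t' s) : IsUpdate t s := by
  rw [IsUpdate, hw] at h
  exact ⟨h.1, h.2.trans (by gcongr)⟩

theorem IsRGCB.isGCB (h : Admissible α β v y b) (ht : IsRGCB α β t) : IsGCB α β t := by
  cases t with
  | nil => trivial
  | node a l r =>
    exact (ht.update_left h ⟨by simp, by simp⟩ ht.2.1).1

/-- A sub-tree of weight `1` would leave weight `n - 1` to the other, against the robust bound `α *
(n - 1)`. Non-empty sub-trees are needed to delete a successor, and to keep descending towards the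
least key. -/
theorem IsRGCB.exists_node (h : Admissible α β v y b) (h31 : 31 ≤ weight t)
    (ht : IsRGCB α β t) : ∃ a l r, t = node a l r ∧ l ≠ nil ∧ r ≠ nil := by
  obtain ⟨a, l, r, rfl⟩ := exists_node_of_lt_weight le_rfl (show 1 < weight t by linarith)
  have h1 := ht.1.1.2
  rw [maxChild_node, max_le_iff, weight_node] at h1
  rw [weight_node] at h31
  have h2 : α * (weight l + weight r - 1) ≤ 3 / 4 * (weight l + weight r - 1) := by
    have := h.α_le
    gcongr
    linarith
  refine ⟨a, l, r, rfl, ?_, ?_⟩ <;> rintro rfl <;> simp only [weight_nil] at * <;> linarith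

theorem le_weight_of_le_numNodes (h : 30 ≤ t.numNodes) : 31 ≤ weight t := by
  rw [weight_eq_numNodes]
  have : (30 : ℝ) ≤ t.numNodes := by exact_mod_cast h
  linarith

theorem numNodes_eq_of_weight_eq (h : weight t' = weight t) : t'.numNodes = t.numNodes := by
  rw [weight_eq_numNodes, weight_eq_numNodes] at h
  exact_mod_cast add_right_cancel h

variable [LinearOrder K]

theorem IsBST.abs_weight_sub_le_of_insert (ht : IsBST t) (ht' : IsBST t') {x : K}
    (hk : keys t' = insert x (keys t)) : |weight t' - weight t| ≤ 1 := by
  rw [ht.weight_eq, ht'.weight_eq, hk]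
  by_cases hx : x ∈ keys t
  · rw [Set.insert_eq_of_mem hx]
    simp
  · rw [Set.ncard_insert_of_notMem hx (finite_keys t)]
    simp

theorem IsBST.abs_weight_sub_le_of_diff (ht : IsBST t) (ht' : IsBST t') {x : K}
    (hk : keys t' = keys t \ {x}) : |weight t' - weight t| ≤ 1 := by
  by_cases hx : x ∈ keys t
  · rw [abs_sub_comm]
    exact ht'.abs_weight_sub_le_of_insert ht (x := x) (by simp [hk, hx])
  · rw [Set.sdiff_singleton_eq_self hx] at hk
    rw [ht.weight_eq, ht'.weight_eq, hk]
    simp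

end Updates

/-! ### The top-down algorithms -/

section TopDown

variable {K : Type*} [LinearOrder K] {α β b : ℝ} {x : K} {T T' : BinaryTree K}

/-- The properties of a rebalanced large tree. -/
theorem Rebalance.outcome (h : Admissible α β (alphaHat α) (betaHat α β) b)
    (size : 30 ≤ T.numNodes) (hbst : IsBST T) (hgcb : IsGCB α β T) {T₁ : BinaryTree K}
    (reb : Rebalance α β T T₁) :
    IsRGCB α β T₁ ∧ IsBST T₁ ∧ keys T₁ = keys T ∧
      ∀ s : BinaryTree K, IsUpdate T₁ s → IsUpdate T s := by
  obtain ⟨h1, h2⟩ := RCGCBalancing.isRGCB h hgcb (le_weight_of_le_numNodes size) reb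
  have h3 := RCGCBalancing.preservesKeys reb
  exact ⟨h1, h3.2 hbst, h3.1, fun s hs ↦ hs.of_le (RCGCBalancing.weight_eq reb) h2⟩

theorem exists_rebalance (h : Admissible α β (alphaHat α) (betaHat α β) b)
    (size : 30 ≤ T.numNodes) (hbst : IsBST T) (hgcb : IsGCB α β T) : ∃ (a : K) (l r : BinaryTree K),
    Rebalance α β T (node a l r) ∧ l ≠ nil ∧ r ≠ nil ∧ (IsBST l ∧ IsBST r) ∧
      (IsGCB α β l ∧ IsGCB α β r) ∧ l.numNodes < T.numNodes ∧ r.numNodes < T.numNodes := by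
  have h31 := le_weight_of_le_numNodes size
  obtain ⟨T₁, reb⟩ := exists_rcgcBalancing h h31
  obtain ⟨h1, h2, h3, -⟩ := Rebalance.outcome h size hbst hgcb reb
  have hw := RCGCBalancing.weight_eq reb
  obtain ⟨a, l, r, rfl, hl, hr⟩ := h1.exists_node h (by rwa [hw])
  have := numNodes_eq_of_weight_eq hw
  rw [numNodes] at this
  exact ⟨a, l, r, reb, hl, hr, h2.2.2, h1.2, by omega, by omega⟩

/-- The clause `IsUpdate T T'` is what the induction feeds on: the rebalanced parent tolerates any
such change of its sub-tree, and passes the same property upwards. -/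
theorem TDInsert.outcome (h : Admissible α β (alphaHat α) (betaHat α β) b)
    (hT : TDInsert α β x T T') (hbst : IsBST T) (hgcb : IsGCB α β T) :
    IsGCB α β T' ∧ IsBST T' ∧ keys T' = insert x (keys T) ∧ IsUpdate T T' := by
  have hα := h.α_ge
  have hβ := h.b_le_β.trans' h.b_ge
  induction hT with
  | small T T' size bst hkeys perfect =>
    exact ⟨perfect.isGCB (by linarith) (by linarith), bst, hkeys,
      perfect.isUpdate (hbst.abs_weight_sub_le_of_insert bst hkeys)⟩
  | found T l r size reb =>
    obtain ⟨h1, h2, h3, h4⟩ := Rebalance.outcome h size hbst hgcb reb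
    refine ⟨h1.isGCB h, h2, ?_, h4 _ ⟨by simp, by simp⟩⟩
    rw [← h3, keys, Set.insert_idem]
  | left T a l r l' size reb lt rec ih =>
    obtain ⟨h1, h2, h3, h4⟩ := Rebalance.outcome h size hbst hgcb reb
    obtain ⟨i1, i2, i3, i4⟩ := ih h2.2.2.1 h1.2.1
    obtain ⟨j1, j2⟩ := h1.update_left h i4 i1
    refine ⟨j1, ⟨?_, h2.2.1, i2, h2.2.2.2⟩, ?_, h4 _ j2⟩
    · rw [i3]
      rintro k (rfl | hk)
      exacts [lt, h2.1 k hk]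
    · rw [← h3, keys, keys, i3, Set.insert_union, Set.insert_comm]
  | right T a l r r' size reb lt rec ih =>
    obtain ⟨h1, h2, h3, h4⟩ := Rebalance.outcome h size hbst hgcb reb
    obtain ⟨i1, i2, i3, i4⟩ := ih h2.2.2.2 h1.2.2
    obtain ⟨j1, j2⟩ := h1.update_right h i4 i1
    refine ⟨j1, ⟨h2.1, ?_, h2.2.2.1, i2⟩, ?_, h4 _ j2⟩
    · rw [i3]
      rintro k (rfl | hk)
      exacts [lt, h2.2.1 k hk]
    · rw [← h3, keys, keys, i3, Set.union_insert, Set.insert_comm]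

theorem exists_tdInsert (h : Admissible α β (alphaHat α) (betaHat α β) b) (x : K)
    (T : BinaryTree K) (hbst : IsBST T) (hgcb : IsGCB α β T) : ∃ T', TDInsert α β x T T' := by
  induction hn : T.numNodes using Nat.strong_induction_on generalizing T with
  | _ n ih =>
    subst hn
    rcases le_or_gt T.numNodes 29 with size | size
    · obtain ⟨T', h1, h2, h3⟩ := exists_perfectlyBalanced ((finite_keys T).insert x)
      exact ⟨T', .small T T' size h1 h2 h3⟩
    · obtain ⟨a, l, r, reb, -, -, ⟨bl, br⟩, ⟨gl, gr⟩, nl, nr⟩ := exists_rebalance h size hbst hgcb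
      rcases lt_trichotomy x a with lt | rfl | lt
      · obtain ⟨l', hl'⟩ := ih _ nl l bl gl rfl
        exact ⟨_, .left T a l r l' size reb lt hl'⟩
      · exact ⟨_, .found T l r size reb⟩
      · obtain ⟨r', hr'⟩ := ih _ nr r br gr rfl
        exact ⟨_, .right T a l r r' size reb lt hr'⟩

/-- Leastness of the removed key is recorded so that it can separate the two sub-trees when it
replaces a deleted root. -/
theorem TDDeleteMin.outcome (h : Admissible α β (alphaHat α) (betaHat α β) b)
    (hT : TDDeleteMin α β x T T') (hbst : IsBST T) (hgcb : IsGCB α β T) :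
    IsLeast (keys T) x ∧ IsGCB α β T' ∧ IsBST T' ∧ keys T' = keys T \ {x} ∧ IsUpdate T T' := by
  have hα := h.α_ge
  have hβ := h.b_le_β.trans' h.b_ge
  induction hT with
  | small T T' size least bst hkeys perfect =>
    exact ⟨least, perfect.isGCB (by linarith) (by linarith), bst, hkeys,
      perfect.isUpdate (hbst.abs_weight_sub_le_of_diff bst hkeys)⟩
  | left T a l r l' size reb rec ih =>
    obtain ⟨h1, h2, h3, h4⟩ := Rebalance.outcome h size hbst hgcb reb
    obtain ⟨i0, i1, i2, i3, i4⟩ := ih h2.2.2.1 h1.2.1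
    obtain ⟨j1, j2⟩ := h1.update_left h i4 i1
    have lt := h2.1 x i0.1
    refine ⟨⟨?_, ?_⟩, j1, ⟨?_, h2.2.1, i2, h2.2.2.2⟩, ?_, h4 _ j2⟩
    · rw [← h3]
      exact .inr (.inl i0.1)
    · rw [← h3]
      rintro k (rfl | hk | hk)
      exacts [lt.le, i0.2 hk, (lt.trans (h2.2.1 k hk)).le]
    · rw [i3]
      exact fun k hk ↦ h2.1 k hk.1
    · have hr : x ∉ keys r := fun hx ↦ lt_asymm lt (h2.2.1 x hx)
      rw [← h3, keys, keys, i3, Set.insert_sdiff_of_notMem _ (by simpa using lt.ne'),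
        Set.union_sdiff_distrib, Set.sdiff_singleton_eq_self hr]

theorem exists_tdDeleteMin (h : Admissible α β (alphaHat α) (betaHat α β) b)
    (T : BinaryTree K) (hbst : IsBST T) (hgcb : IsGCB α β T) (hne : T ≠ nil) :
    ∃ m T', TDDeleteMin α β m T T' := by
  induction hn : T.numNodes using Nat.strong_induction_on generalizing T with
  | _ n ih =>
    subst hn
    rcases le_or_gt T.numNodes 29 with size | size
    · obtain ⟨m, hm⟩ : ∃ m, IsLeast (keys T) m := by
        have : (keys T).Nonempty := by
          cases T with
          | nil => exact absurd rfl hne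
          | node a l r => exact ⟨a, .inl rfl⟩
        obtain ⟨m, hm, hm'⟩ := (finite_keys T).exists_minimal this
        exact ⟨m, hm, fun k hk ↦ (le_total m k).elim id (hm' hk)⟩
      obtain ⟨T', h1, h2, h3⟩ := exists_perfectlyBalanced ((finite_keys T).sdiff (t := {m}))
      exact ⟨m, T', .small T T' size hm h1 h2 h3⟩
    · obtain ⟨a, l, r, reb, hl, -, ⟨bl, -⟩, ⟨gl, -⟩, nl, -⟩ := exists_rebalance h size hbst hgcb
      obtain ⟨m, l', hl'⟩ := ih _ nl l bl gl hl rfl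
      exact ⟨m, _, .left T a l r l' size reb hl'⟩

theorem TDDelete.outcome (h : Admissible α β (alphaHat α) (betaHat α β) b)
    (hT : TDDelete α β x T T') (hbst : IsBST T) (hgcb : IsGCB α β T) :
    IsGCB α β T' ∧ IsBST T' ∧ keys T' = keys T \ {x} ∧ IsUpdate T T' := by
  have hα := h.α_ge
  have hβ := h.b_le_β.trans' h.b_ge
  induction hT with
  | small T T' size bst hkeys perfect =>
    exact ⟨perfect.isGCB (by linarith) (by linarith), bst, hkeys,
      perfect.isUpdate (hbst.abs_weight_sub_le_of_diff bst hkeys)⟩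
  | found T l r r' m size reb rec =>
    obtain ⟨h1, h2, h3, h4⟩ := Rebalance.outcome h size hbst hgcb reb
    obtain ⟨i0, i1, i2, i3, i4⟩ := rec.outcome h h2.2.2.2 h1.2.2
    obtain ⟨j1, j2⟩ := h1.update_right h i4 i1
    have lt := h2.2.1 m i0.1
    refine ⟨j1, ⟨fun k hk ↦ (h2.1 k hk).trans lt, ?_, h2.2.2.1, i2⟩, ?_, h4 _ j2⟩
    · rw [i3]
      exact fun k hk ↦ lt_of_le_of_ne (i0.2 hk.1) fun e ↦ hk.2 e.symm
    · have hx : x ∉ keys l ∪ keys r := by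
        rintro (hx | hx)
        exacts [lt_irrefl _ (h2.1 x hx), lt_irrefl _ (h2.2.1 x hx)]
      rw [← h3, keys, keys, i3, Set.insert_sdiff_self_of_notMem hx, ← Set.union_insert,
        Set.insert_sdiff_singleton, Set.insert_eq_of_mem i0.1]
  | left T a l r l' size reb lt rec ih =>
    obtain ⟨h1, h2, h3, h4⟩ := Rebalance.outcome h size hbst hgcb reb
    obtain ⟨i1, i2, i3, i4⟩ := ih h2.2.2.1 h1.2.1
    obtain ⟨j1, j2⟩ := h1.update_left h i4 i1
    refine ⟨j1, ⟨?_, h2.2.1, i2, h2.2.2.2⟩, ?_, h4 _ j2⟩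
    · rw [i3]
      exact fun k hk ↦ h2.1 k hk.1
    · have hr : x ∉ keys r := fun hx ↦ lt_asymm lt (h2.2.1 x hx)
      rw [← h3, keys, keys, i3, Set.insert_sdiff_of_notMem _ (by simpa using lt.ne'),
        Set.union_sdiff_distrib, Set.sdiff_singleton_eq_self hr]
  | right T a l r r' size reb lt rec ih =>
    obtain ⟨h1, h2, h3, h4⟩ := Rebalance.outcome h size hbst hgcb reb
    obtain ⟨i1, i2, i3, i4⟩ := ih h2.2.2.2 h1.2.2
    obtain ⟨j1, j2⟩ := h1.update_right h i4 i1
    refine ⟨j1, ⟨h2.1, ?_, h2.2.2.1, i2⟩, ?_, h4 _ j2⟩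
    · rw [i3]
      exact fun k hk ↦ h2.2.1 k hk.1
    · have hl : x ∉ keys l := fun hx ↦ lt_asymm lt (h2.1 x hx)
      rw [← h3, keys, keys, i3, Set.insert_sdiff_of_notMem _ (by simpa using lt.ne),
        Set.union_sdiff_distrib, Set.sdiff_singleton_eq_self hl]

theorem exists_tdDelete (h : Admissible α β (alphaHat α) (betaHat α β) b) (x : K)
    (T : BinaryTree K) (hbst : IsBST T) (hgcb : IsGCB α β T) : ∃ T', TDDelete α β x T T' := by
  induction hn : T.numNodes using Nat.strong_induction_on generalizing T with
  | _ n ih =>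
    subst hn
    rcases le_or_gt T.numNodes 29 with size | size
    · obtain ⟨T', h1, h2, h3⟩ := exists_perfectlyBalanced ((finite_keys T).sdiff (t := {x}))
      exact ⟨T', .small T T' size h1 h2 h3⟩
    · obtain ⟨a, l, r, reb, -, hr, ⟨bl, br⟩, ⟨gl, gr⟩, nl, nr⟩ := exists_rebalance h size hbst hgcb
      rcases lt_trichotomy x a with lt | rfl | lt
      · obtain ⟨l', hl'⟩ := ih _ nl l bl gl rfl
        exact ⟨_, .left T a l r l' size reb lt hl'⟩
      · obtain ⟨m, r', hr'⟩ := exists_tdDeleteMin h r br gr hr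
        exact ⟨_, .found T l r r' m size reb hr'⟩
      · obtain ⟨r', hr'⟩ := ih _ nr r br gr rfl
        exact ⟨_, .right T a l r r' size reb lt hr'⟩

end TopDown

end GCBTree

theorem theorem4 {K : Type*} [LinearOrder K] (α β : ℝ)
    (hα : 1 / √2 ≤ α) (hα' : α < 3 / 4) (hβ : GCBTree.B α ≤ β) (hβ' : β ≤ α ^ 2)
    (T : BinaryTree K) (hbst : GCBTree.IsBST T) (hgcb : GCBTree.IsGCB α β T) (x : K) :
    -- a large tree is rebalanced into one whose root is robustly balanced
    (30 ≤ T.numNodes →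
      ∀ T₁ : BinaryTree K, GCBTree.Rebalance α β T T₁ → GCBTree.IsRGCB α β T₁) ∧
    -- insertion
    ((∃ T' : BinaryTree K, GCBTree.TDInsert α β x T T') ∧
      ∀ T' : BinaryTree K, GCBTree.TDInsert α β x T T' →
        GCBTree.IsGCB α β T' ∧ GCBTree.IsBST T' ∧
          GCBTree.keys T' = insert x (GCBTree.keys T)) ∧
    -- deletion
    ((∃ T' : BinaryTree K, GCBTree.TDDelete α β x T T') ∧
      ∀ T' : BinaryTree K, GCBTree.TDDelete α β x T T' →
        GCBTree.IsGCB α β T' ∧ GCBTree.IsBST T' ∧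
          GCBTree.keys T' = GCBTree.keys T \ {x}) := by
  have h := GCBTree.admissible hα hα' hβ hβ'
  refine ⟨fun size T₁ reb ↦ (GCBTree.Rebalance.outcome h size hbst hgcb reb).1,
    ⟨GCBTree.exists_tdInsert h x T hbst hgcb, fun T' hT ↦ ?_⟩,
    GCBTree.exists_tdDelete h x T hbst hgcb, fun T' hT ↦ ?_⟩
  · obtain ⟨h1, h2, h3, -⟩ := hT.outcome h hbst hgcb
    exact ⟨h1, h2, h3⟩
  · obtain ⟨h1, h2, h3, -⟩ := hT.outcome h hbst hgcb
    exact ⟨h1, h2, h3⟩
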